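/- **Setting.** Let $\mathcal A$ be a finite alphabet, $\sigma$ the shift on $\mathcal A^{\mathbb Z}$, $\sigma(\mathbf a)_z=a_{z+1}$, and let $\Phi:\mathcal A^{\mathbb Z}\to\mathcal A^{\mathbb Z}$ be a nearest-neighbour cellular automaton, $\Phi(\mathbf a)_z=\phi(a_{z-1},a_z,a_{z+1})$. A *subshift* is a closed set $\mathbf S\subseteq\mathcal A^{\mathbb Z}$ with $\sigma(\mathbf S)=\mathbf S$; $\mathbf S_n$ is the set of words of length $n$ occurring in $\mathbf S$; $\mathbf S$ is *Markov* if $\mathbf S=\{\mathbf s:(s_z,s_{z+1})\in\mathbf S_2\ \forall z\}$. Put $\mathcal P_{\mathbf S}(b)=\{a:(a,b)\in\mathbf S_2\}$ and $\mathcal F_{\mathbf S}(b)=\{c:(b,c)\in\mathbf S_2\}$. $\mathbf S$ is *left-regular* (resp. *right-regular*) if $\#\mathcal P_{\mathbf S}(b)$ (resp. $\#\mathcal F_{\mathbf S}(b)$) is the same for all $b\in\mathbf S_1$. $\mathbf S$ is *left-resolving* for $\Phi$ if $\Phi(\mathbf S)\subseteq\mathbf S$ and, for every $(b,c,d)\in\mathbf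 S_3$, the map $a\mapsto\phi(a,b,c)$ is injective on $\mathcal P_{\mathbf S}(b)$; it is *right-resolving* if $\Phi(\mathbf S)\subseteq\mathbf S$ and, for every $(a,b,c)\in\mathbf S_3$, the map $d\mapsto\phi(b,c,d)$ is injective on $\mathcal F_{\mathbf S}(c)$. A *Parry measure* on $\mathbf S$ is a $\sigma$-invariant Borel probability measure on $\mathbf S$ whose shift-entropy is maximal among all such measures. $\mathrm{Fix}(\Phi^p,\sigma^q)$ is the set of $\mathbf a$ with $\Phi^p(\mathbf a)=\mathbf a=\sigma^q(\mathbf a)$. **Defects.** Fix a Markov subshift $\mathbf S$ with $\Phi(\mathbf S)\subseteq\mathbf S$, and subshifts $\mathbf L,\mathbf R\subseteq\mathbf S$. If the set of $j\in\mathbb Z$ with $(a_j,a_{j+1})\notin\mathbf S_2$ is non-empty and bounded, with smallest element $i$ and largest element $k$, then $\mathbf a$ has a defect of width $w=k-i$ at position $z=i+\lceil w/2\rceil$. For $W\in\mathbb N$, the window of width $W$ at $z$ is the interval $[z+1-\lceil W/2\rceil,\ z+\lfloor W/2\rfloor]$ of $W$ cells. Let $\mathbf D^{W}_{\mathbf L,\mathbf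 R}$ be the set of $\mathbf a$ such that, for every $t\in\mathbb N$, $\Phi^t(\mathbf a)$ has a defect of width at most $W$, at some position $z_t=z_t(\mathbf a)$, the part of $\Phi^t(\mathbf a)$ to the left of the window of width $W$ at $z_t$ is the left half $[\dots s_{-2}\,s_{-1}]$ of some $\mathbf s\in\mathbf L$, and the part to the right of that window is the right half $[s_1\,s_2\dots]$ of some $\mathbf s\in\mathbf R$. Let $\mathbf D^{W,0}_{\mathbf L,\mathbf R}=\{\mathbf a\in\mathbf D^W_{\mathbf L,\mathbf R}: z_0(\mathbf a)=0\}$. For Borel probability measures $\lambda$ on $\mathbf L$, $\rho$ on $\mathbf R$ and $\delta$ on $\mathcal A^W$, let $\lambda\otimes\delta\otimes\rho$ be the law of $[\dots l_{-2}\,l_{-1}\,d_1\dots d_W\,r_1\,r_2\dots]$, with $d_1\dots d_W$ in the window of width $W$ at $0$, where $\mathbf l\sim\lambda$, $\mathbf d\sim\delta$, $\mathbf r\sim\rho$ are independent. **Random walks.** A *hidden Markov measure* on $\mathbb Z^{\mathbb N}$ is the law of $(\psi(x_0),\psi(x_1),\dots)$ for a time-homogeneous Markov chain $(x_n)$ (with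 any initial law) on a finite set $\mathcal X$ and a function $\psi:\mathcal X\to\mathbb Z$. A *(generalized) random walk* is the law on $\mathbb Z^{\mathbb N}$ of $(0,\,v_0,\,v_0+v_1,\,v_0+v_1+v_2,\dots)$, where the law of $(v_n)_{n\ge0}$ is a hidden Markov measure. **Corollary 3.2.** Let $p,q\ge1$. Suppose that either [i] $\mathbf L\subseteq\mathrm{Fix}(\Phi^p,\sigma^q)$ and $\lambda$ is any Borel probability measure on $\mathbf L$, while $\mathbf R$ is a right-resolving, right-regular Markov subshift and $\rho$ is a Parry measure on $\mathbf R$; or [ii] $\mathbf L$ is a left-resolving, left-regular Markov subshift and $\lambda$ is a Parry measure on $\mathbf L$, while $\mathbf R\subseteq\mathrm{Fix}(\Phi^p,\sigma^q)$ and $\rho$ is any Borel probability measure on $\mathbf R$. Let $W\in\mathbb N$, let $\delta$ be any probability measure on $\mathcal A^W$, and suppose that $\mu:=\lambda\otimes\delta\otimes\rho$ is carried by $\mathbf D^{W,0}_{\mathbf L,\mathbf R}$. Then the law under $\mu$ of the sampled trajectory $(z_0,z_p,z_{2p},\dots)$ of the defect is a random walk. -/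

import Mathlib

open MeasureTheory Filter Topology

noncomputable section

namespace DefectWalk

variable {A : Type*}

/-! ### Sequences, shift, cellular automata -/

/-- The shift map on bi-infinite sequences, `(shift a) z = a (z + 1)`. -/
def shift (a : ℤ → A) : ℤ → A := fun z => a (z + 1)

/-- The nearest-neighbour cellular automaton with local rule `φ`. -/
def caMap (φ : A → A → A → A) (a : ℤ → A) : ℤ → A :=
  fun z => φ (a (z - 1)) (a z) (a (z + 1))

/-- `Fix(Φ^p, σ^q)`: the sequences fixed both by `Φ^p` and by `σ^q`. -/
def fixSet (φ : A → A → A → A) (p q : ℕ) : Set (ℤ → A) :=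
  {a | (caMap φ)^[p] a = a ∧ shift^[q] a = a}

/-! ### Subshifts -/

/-- A subshift: closed in the product topology, and `σ(S) = S`. -/
def IsSubshift [TopologicalSpace A] (S : Set (ℤ → A)) : Prop :=
  IsClosed S ∧ shift '' S = S

/-- `a` is a letter occurring in `S` (for shift-invariant `S` the position is irrelevant). -/
def Adm1 (S : Set (ℤ → A)) (a : A) : Prop := ∃ s ∈ S, s 0 = a

/-- `(a, b)` is an admissible transition (admissible 2-word) of `S`. -/
def Adm2 (S : Set (ℤ → A)) (a b : A) : Prop := ∃ s ∈ S, s 0 = a ∧ s 1 = b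

/-- `(a, b, c)` is an admissible 3-word of `S`. -/
def Adm3 (S : Set (ℤ → A)) (a b c : A) : Prop := ∃ s ∈ S, s 0 = a ∧ s 1 = b ∧ s 2 = c

/-- A Markov subshift: a subshift that consists of all bi-infinite sequences all of whose
transitions are admissible. -/
def IsMarkovSubshift [TopologicalSpace A] (S : Set (ℤ → A)) : Prop :=
  IsSubshift S ∧ S = {s | ∀ z : ℤ, Adm2 S (s z) (s (z + 1))}

/-- The predecessor set of a letter. -/
def predSet (S : Set (ℤ → A)) (b : A) : Set A := {a | Adm2 S a b}

/-- The follower set of a letter. -/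
def follSet (S : Set (ℤ → A)) (b : A) : Set A := {c | Adm2 S b c}

/-- Left-regular: all letters of `S` have the same number of predecessors. -/
def IsLeftRegular (S : Set (ℤ → A)) : Prop :=
  ∃ P : ℕ, ∀ b, Adm1 S b → (predSet S b).ncard = P

/-- Right-regular: all letters of `S` have the same number of followers. -/
def IsRightRegular (S : Set (ℤ → A)) : Prop :=
  ∃ F : ℕ, ∀ b, Adm1 S b → (follSet S b).ncard = F

/-- `S` is `Φ`-invariant and left-resolving for `Φ`: for every admissible `(b, c, d)`, the map
`a ↦ φ(a, b, c)` from the predecessors of `b` to the predecessors of `φ(b, c, d)` is injective.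
(That the values are predecessors of `φ(b, c, d)` follows from `Φ(S) ⊆ S` for Markov `S`.) -/
def IsLeftResolving (φ : A → A → A → A) (S : Set (ℤ → A)) : Prop :=
  Set.MapsTo (caMap φ) S S ∧
    ∀ b c d, Adm3 S b c d → Set.InjOn (fun a => φ a b c) (predSet S b)

/-- `S` is `Φ`-invariant and right-resolving for `Φ`: for every admissible `(a, b, c)`, the map
`d ↦ φ(b, c, d)` from the followers of `c` to the followers of `φ(a, b, c)` is injective. -/
def IsRightResolving (φ : A → A → A → A) (S : Set (ℤ → A)) : Prop :=
  Set.MapsTo (caMap φ) S S ∧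
    ∀ a b c, Adm3 S a b c → Set.InjOn (fun d => φ b c d) (follSet S c)

/-! ### Entropy and Parry measures -/

/-- The Shannon entropy of the distribution of the block in coordinates `0, …, n - 1`. -/
def blockEntropy [Fintype A] [MeasurableSpace A] (η : Measure (ℤ → A)) (n : ℕ) : ℝ :=
  ∑ w : Fin n → A, Real.negMulLog (η.real {a | ∀ i : Fin n, a ((i : ℕ) : ℤ) = w i})

/-- `h` is the shift-entropy of `η`: the limit of (block entropy of length `n`) divided by `n`.
The limit exists for every shift-invariant probability measure. -/
def HasShiftEntropy [Fintype A] [MeasurableSpace A] (η : Measure (ℤ → A)) (h : ℝ) : Prop :=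
  Tendsto (fun n : ℕ => blockEntropy η n / n) atTop (𝓝 h)

/-- Shift-invariant Borel probability measures carried by `S`. -/
def IsInvariantOn [MeasurableSpace A] (S : Set (ℤ → A)) (η : Measure (ℤ → A)) : Prop :=
  IsProbabilityMeasure η ∧ (∀ᵐ a ∂η, a ∈ S) ∧ η.map shift = η

/-- `η` is a Parry measure of `S`: a shift-invariant probability measure on `S` whose
shift-entropy is maximal among all shift-invariant probability measures on `S`. -/
def IsParryMeasure [Fintype A] [MeasurableSpace A]
    (S : Set (ℤ → A)) (η : Measure (ℤ → A)) : Prop :=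
  IsInvariantOn S η ∧ ∃ h, HasShiftEntropy η h ∧
    ∀ ν h', IsInvariantOn S ν → HasShiftEntropy ν h' → h' ≤ h

/-! ### Defects -/

/-- The positions `j` such that the transition `(a_j, a_{j+1})` is not admissible for the ambient
Markov subshift `S`. -/
def defectSet (S : Set (ℤ → A)) (a : ℤ → A) : Set ℤ := {j | ¬ Adm2 S (a j) (a (j + 1))}

/-- The first inadmissible transition `i`. -/
def defectLeft (S : Set (ℤ → A)) (a : ℤ → A) : ℤ := sInf (defectSet S a)

/-- The last inadmissible transition `k`. -/
def defectRight (S : Set (ℤ → A)) (a : ℤ → A) : ℤ := sSup (defectSet S a)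

/-- The width `w = k - i`; the defect word is `a_{i+1}, …, a_k`. -/
def defectWidth (S : Set (ℤ → A)) (a : ℤ → A) : ℤ := defectRight S a - defectLeft S a

/-- The position `z = i + ⌈w / 2⌉` of the defect, roughly the centre of the defect word. -/
def defectPos (S : Set (ℤ → A)) (a : ℤ → A) : ℤ := defectLeft S a + (defectWidth S a + 1) / 2

/-- A window of width `W` around position `z` occupies the `W` cells
`z + winLo W, …, z + winHi W`, where `winLo W = 1 - ⌈W / 2⌉` and `winHi W = ⌊W / 2⌋`. -/
def winLo (W : ℕ) : ℤ := 1 - ((W : ℤ) + 1) / 2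

/-- See `winLo`. -/
def winHi (W : ℕ) : ℤ := (W : ℤ) / 2

/-- The sequences with an `(L, R)`-defect of width at most `W` relative to the ambient Markov
subshift `S`: there are inadmissible transitions, they lie in a bounded interval of width at most
`W`, the sequence to the left of the window of width `W` around the defect is a left-infinite
`L`-admissible sequence, and to the right of it a right-infinite `R`-admissible sequence. -/
def HasDefect (S L R : Set (ℤ → A)) (W : ℕ) (a : ℤ → A) : Prop :=
  (defectSet S a).Nonempty ∧ BddBelow (defectSet S a) ∧ BddAbove (defectSet S a) ∧
    defectWidth S a ≤ W ∧
    (∃ l ∈ L, ∀ n : ℕ, 1 ≤ n → a (defectPos S a + winLo W - n) = l (-(n : ℤ))) ∧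
    (∃ r ∈ R, ∀ n : ℕ, 1 ≤ n → a (defectPos S a + winHi W + n) = r n)

/-- The sequences with a (persistent) `(L, R)`-defect particle of width `W`. -/
def particleSet (φ : A → A → A → A) (S L R : Set (ℤ → A)) (W : ℕ) : Set (ℤ → A) :=
  {a | ∀ t : ℕ, HasDefect S L R W ((caMap φ)^[t] a)}

/-- The sequences with an `(L, R)`-defect particle of width `W` that starts at position `0`. -/
def particleSetZero (φ : A → A → A → A) (S L R : Set (ℤ → A)) (W : ℕ) : Set (ℤ → A) :=
  {a | a ∈ particleSet φ S L R W ∧ defectPos S a = 0}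

/-- The sequence `[… l_{-2} l_{-1} d_0 … d_{W-1} r_1 r_2 …]`, with the word `d` in the window of
width `W` around position `0`. -/
def glue (W : ℕ) (l : ℤ → A) (d : Fin W → A) (r : ℤ → A) : ℤ → A := fun z =>
  if z < winLo W then l (z - winLo W)
  else if h : (z - winLo W).toNat < W then d ⟨(z - winLo W).toNat, h⟩
  else r (z - winHi W)

/-- The measure `lam ⊗ δ ⊗ rho`: the left half, the word in the window and the right half are
independent, with laws given by `lam`, `δ`, `rho`. -/
def productMeasure [MeasurableSpace A] (W : ℕ) (lam : Measure (ℤ → A))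
    (δ : Measure (Fin W → A)) (rho : Measure (ℤ → A)) : Measure (ℤ → A) :=
  (lam.prod (δ.prod rho)).map (fun x => glue W x.1 x.2.1 x.2.2)

/-- The sampled trajectory `ζ(a) = (z_0, z_p, z_{2p}, …)`, where `z_t` is the position of the
defect in `Φ^t(a)`. -/
def sampledTrajectory (φ : A → A → A → A) (S : Set (ℤ → A)) (p : ℕ) (a : ℤ → A) : ℕ → ℤ :=
  fun k => defectPos S ((caMap φ)^[p * k] a)

/-! ### Markov measures, hidden Markov measures, random walks -/

/-- A (time-homogeneous) Markov measure on `X^ℕ`, with initial law `π` and transition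
probabilities `τ`, described by its values on cylinder sets. -/
def IsMarkovMeasure {X : Type*} [MeasurableSpace X] (m : Measure (ℕ → X)) : Prop :=
  ∃ (π : PMF X) (τ : X → PMF X), ∀ (n : ℕ) (c : ℕ → X),
    m {x | ∀ i ≤ n, x i = c i} = π (c 0) * ∏ i ∈ Finset.range n, τ (c i) (c (i + 1))

/-- A hidden Markov measure with finitely many hidden states: the image of a Markov measure on
`{0, …, N - 1}^ℕ` under a coordinatewise map. -/
def IsHiddenMarkov {V : Type*} [MeasurableSpace V] (ν : Measure (ℕ → V)) : Prop :=
  ∃ (N : ℕ) (m : Measure (ℕ → Fin N)) (ψ : Fin N → V),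
    IsMarkovMeasure m ∧ ν = m.map (fun x k => ψ (x k))

/-- `Σ(v_1, v_2, v_3, …) = (0, v_1, v_1 + v_2, …)`. -/
def partialSums (v : ℕ → ℤ) : ℕ → ℤ := fun n => ∑ i ∈ Finset.range n, v i

/-- A (generalized) random walk: the law of the partial sums of a hidden Markov process of
integer increments. -/
def IsRandomWalk (ω : Measure (ℕ → ℤ)) : Prop :=
  ∃ ν : Measure (ℕ → ℤ), IsHiddenMarkov ν ∧ ω = ν.map partialSums

end DefectWalk

end

/-! In case [i] the randomness enters only from the right and in its simplest form. The argument
rests on the property `UnifFrom`: from some cell on, given everything to the left, the next letter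
is uniform among the `F` admissible followers of the present one.

A Parry measure on a right-regular Markov subshift has this property (`IsParryMeasure.unifFrom`).
Each further letter adds at most `log F` to the block entropy, with equality exactly for uniform
conditional laws, and an averaging construction gives an invariant measure of entropy `log F`
(`exists_invariant_entropy`). Maximality and subadditivity then force equality at every step. Gluing
an independent left half and window onto the Parry measure keeps the property to the right of the
window.

A right-resolving automaton preserves it (`UnifFrom.map_caMap`): with the past fixed, the local rule
maps the `F` followers of the present letter injectively, hence bijectively, onto the `F` followers
of its image.

Now recentre the configuration at its leftmost inadmissible transition and record a finite window
around it. To the left, periodicity makes the window determine all cells; to the right, the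
conditional law is the uniform one. So the window content determines the whole conditional law
(`IsStateLaw.eq_stateLaw`). Defects have speed at most one, so for a large window the displacement
in `p` steps is a function of its content. After `p` steps and recentring, uniformity again holds
beyond the same window (`IsStateLaw.map_step`). Hence the successive window contents form a finite
Markov chain (`isMarkovMeasure_of_fibre`) and the increments of the position are a function of its
states: `isRandomWalk_of_unifFrom`.

Case [ii] is the mirror image of this argument. Reflection exchanges the roles of left and right and
negates the trajectory; negating increments keeps a random walk a random walk. -/

noncomputable section

set_option linter.unusedSectionVars false

namespace DefectWalk

variable {A : Type*}

/-! ### Translations and admissible words -/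

/-- The `k`-th power of the shift, for an integer `k`. -/
def translate (k : ℤ) (a : ℤ → A) : ℤ → A := fun z => a (z + k)

@[simp] lemma translate_apply (k : ℤ) (a : ℤ → A) (z : ℤ) : translate k a z = a (z + k) := rfl

lemma translate_translate (j k : ℤ) (a : ℤ → A) :
    translate j (translate k a) = translate (j + k) a := by
  funext z; simp [add_assoc]

@[simp] lemma translate_zero (a : ℤ → A) : translate 0 a = a := by
  funext z; simp

lemma shift_eq_translate (a : ℤ → A) : shift a = translate 1 a := rfl

lemma translate_mem {S : Set (ℤ → A)} (hS : shift '' S = S) {s : ℤ → A} (hs : s ∈ S) (k : ℤ) :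
    translate k s ∈ S := by
  induction k using Int.induction_on with
  | zero => simpa using hs
  | succ k ih =>
    have h : shift (translate k s) ∈ S := hS ▸ Set.mem_image_of_mem _ ih
    rwa [shift_eq_translate, translate_translate, add_comm] at h
  | pred k ih =>
    have h := ih
    rw [← hS] at h
    obtain ⟨y, hy, hys⟩ := h
    have : translate (-(k : ℤ) - 1) s = y := by
      funext z
      have h1 := congrFun hys (z - 1)
      simp only [shift, translate_apply, sub_add_cancel] at h1
      rw [h1, translate_apply]
      congr 1; ring
    rwa [this]

lemma adm2_of_mem {S : Set (ℤ → A)} (hS : shift '' S = S) {s : ℤ → A} (hs : s ∈ S) (z : ℤ) :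
    Adm2 S (s z) (s (z + 1)) :=
  ⟨translate z s, translate_mem hS hs z, by simp, by simp [add_comm]⟩

lemma adm1_of_mem {S : Set (ℤ → A)} (hS : shift '' S = S) {s : ℤ → A} (hs : s ∈ S) (z : ℤ) :
    Adm1 S (s z) :=
  ⟨translate z s, translate_mem hS hs z, by simp⟩

lemma Adm2.left {S : Set (ℤ → A)} {a b : A} (h : Adm2 S a b) : Adm1 S a := by
  obtain ⟨s, hs, h0, -⟩ := h
  exact ⟨s, hs, h0⟩

lemma Adm2.right {S : Set (ℤ → A)} (hS : shift '' S = S) {a b : A} (h : Adm2 S a b) :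
    Adm1 S b := by
  obtain ⟨s, hs, -, h1⟩ := h
  exact h1 ▸ adm1_of_mem hS hs 1

lemma Adm1.exists_right {S : Set (ℤ → A)} {a : A} (h : Adm1 S a) : ∃ b, Adm2 S a b := by
  obtain ⟨s, hs, h0⟩ := h
  exact ⟨s 1, s, hs, h0, rfl⟩

lemma IsMarkovSubshift.mem_iff [TopologicalSpace A] {S : Set (ℤ → A)} (hS : IsMarkovSubshift S)
    (s : ℤ → A) : s ∈ S ↔ ∀ z : ℤ, Adm2 S (s z) (s (z + 1)) :=
  ⟨fun h => adm2_of_mem hS.1.2 h, fun h => hS.2 ▸ h⟩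

/-- In a Markov subshift, the left half of one point and the right half of another can be joined
along an admissible transition. -/
lemma IsMarkovSubshift.join_mem [TopologicalSpace A] {S : Set (ℤ → A)} (hS : IsMarkovSubshift S)
    {s t : ℤ → A} (hs : s ∈ S) (ht : t ∈ S) {k : ℤ} (hk : Adm2 S (s k) (t (k + 1))) :
    (fun z => if z ≤ k then s z else t z) ∈ S := by
  rw [hS.mem_iff]
  intro z
  rcases lt_trichotomy z k with h | h | h
  · simpa [h.le, Int.add_one_le_iff.2 h] using adm2_of_mem hS.1.2 hs z
  · subst h
    simpa using hk
  · simpa [h.not_ge, (h.trans (lt_add_one z)).not_ge] using adm2_of_mem hS.1.2 ht z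

/-- Points witnessing the first and the last transition are pasted along the middle one. -/
lemma IsMarkovSubshift.adm_four [TopologicalSpace A] {S : Set (ℤ → A)} (hS : IsMarkovSubshift S)
    {a b c d : A} (hab : Adm2 S a b) (hbc : Adm2 S b c) (hcd : Adm2 S c d) :
    ∃ s ∈ S, s 0 = a ∧ s 1 = b ∧ s 2 = c ∧ s 3 = d := by
  obtain ⟨s, hs, h0, h1⟩ := hab
  obtain ⟨t, ht, h2, h3⟩ := hcd
  refine ⟨_, hS.join_mem hs (translate_mem hS.1.2 ht (-2)) (k := 1) ?_, ?_, ?_, ?_, ?_⟩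
  · simpa [h1, h2] using hbc
  · simpa using h0
  · simpa using h1
  · simpa using h2
  · simpa using h3

lemma IsMarkovSubshift.adm3 [TopologicalSpace A] {S : Set (ℤ → A)} (hS : IsMarkovSubshift S)
    {a b c : A} (hab : Adm2 S a b) (hbc : Adm2 S b c) : Adm3 S a b c := by
  obtain ⟨d, hd⟩ := (hbc.right hS.1.2).exists_right
  obtain ⟨s, hs, h0, h1, h2, -⟩ := hS.adm_four hab hbc hd
  exact ⟨s, hs, h0, h1, h2⟩

/-- A local form of invariance: the four letters extend to a point of `S`, whose image is again in
`S`. This makes invariance usable on configurations with defects, which are not themselves in `S`.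
-/
lemma IsMarkovSubshift.adm2_rule [TopologicalSpace A] {S : Set (ℤ → A)} (hS : IsMarkovSubshift S)
    {φ : A → A → A → A} (hφ : Set.MapsTo (caMap φ) S S) {a b c d : A}
    (hab : Adm2 S a b) (hbc : Adm2 S b c) (hcd : Adm2 S c d) :
    Adm2 S (φ a b c) (φ b c d) := by
  obtain ⟨s, hs, h0, h1, h2, h3⟩ := hS.adm_four hab hbc hcd
  have h := adm2_of_mem hS.1.2 (hφ hs) 1
  simpa [caMap, h0, h1, h2, h3] using h

lemma IsMarkovSubshift.adm2_caMap [TopologicalSpace A] {S : Set (ℤ → A)}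
    (hS : IsMarkovSubshift S) {φ : A → A → A → A} (hφ : Set.MapsTo (caMap φ) S S) {a : ℤ → A}
    {z : ℤ} (h : ∀ j, z - 1 ≤ j → j ≤ z + 1 → Adm2 S (a j) (a (j + 1))) :
    Adm2 S (caMap φ a z) (caMap φ a (z + 1)) := by
  have h1 := h (z - 1) le_rfl (by omega)
  have h2 := h z (by omega) (by omega)
  have h3 := h (z + 1) (by omega) le_rfl
  simp only [sub_add_cancel] at h1
  simpa [caMap] using hS.adm2_rule hφ h1 h2 h3

lemma caMap_translate (φ : A → A → A → A) (k : ℤ) (a : ℤ → A) :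
    caMap φ (translate k a) = translate k (caMap φ a) := by
  funext z
  simp only [caMap, translate_apply]
  congr 2 <;> ring_nf

lemma iterate_caMap_translate (φ : A → A → A → A) (k : ℤ) (t : ℕ) (a : ℤ → A) :
    (caMap φ)^[t] (translate k a) = translate k ((caMap φ)^[t] a) := by
  induction t with
  | zero => rfl
  | succ t ih => rw [Function.iterate_succ_apply', Function.iterate_succ_apply', ih,
      caMap_translate]

/-- The value of the `t`-th iterate on `(-∞, n]` depends only on the cells in `(-∞, n + t]`. -/
lemma iterate_caMap_eq_of_le (φ : A → A → A → A) (t : ℕ) {a b : ℤ → A} {n : ℤ}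
    (h : ∀ z ≤ n + t, a z = b z) : ∀ z ≤ n, (caMap φ)^[t] a z = (caMap φ)^[t] b z := by
  induction t generalizing n with
  | zero => simpa using h
  | succ t ih =>
    intro z hz
    have ih' := ih (n := n + 1) (fun z hz => h z (by push_cast; omega))
    simp only [Function.iterate_succ_apply', caMap]
    rw [ih' _ (by omega), ih' _ (by omega), ih' _ (by omega)]

/-! ### Measurability -/

lemma measurable_translate [MeasurableSpace A] (k : ℤ) :
    Measurable (translate k : (ℤ → A) → (ℤ → A)) :=
  measurable_pi_lambda _ fun z => measurable_pi_apply (z + k)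

lemma measurable_shift [MeasurableSpace A] : Measurable (shift : (ℤ → A) → (ℤ → A)) :=
  measurable_translate 1

section Measurability
variable [Finite A] [MeasurableSpace A] [MeasurableSingletonClass A]

lemma measurableSet_coord (P : A → Prop) (z : ℤ) : MeasurableSet {a : ℤ → A | P (a z)} :=
  (measurable_pi_apply z) (MeasurableSet.of_discrete (s := {x | P x}))

lemma measurableSet_coord₂ (P : A → A → Prop) (z w : ℤ) :
    MeasurableSet {a : ℤ → A | P (a z) (a w)} := by
  have h : Measurable fun a : ℤ → A => (a z, a w) := by fun_prop
  exact h (MeasurableSet.of_discrete (s := {x : A × A | P x.1 x.2}))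

lemma measurable_caMap (φ : A → A → A → A) : Measurable (caMap φ) := by
  refine measurable_pi_lambda _ fun z => ?_
  have h : Measurable fun a : ℤ → A => (a (z - 1), a z, a (z + 1)) := by fun_prop
  exact (Measurable.of_discrete (f := fun x : A × A × A => φ x.1 x.2.1 x.2.2)).comp h

end Measurability

/-- A set that is almost everywhere covered exactly once by a finite family has as measure the sum
of the measures of its parts. -/
lemma measure_eq_sum_of_existsUnique {Ω ι : Type*} [MeasurableSpace Ω] [Fintype ι]
    {m : Measure Ω} {E : Set Ω} {V : ι → Set Ω} (hE : MeasurableSet E)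
    (hV : ∀ i, MeasurableSet (V i)) (h : ∀ᵐ a ∂m, a ∈ E → ∃! i, a ∈ V i) :
    m E = ∑ i, m (E ∩ V i) := by
  classical
  have h1 : ∀ i, m (E ∩ V i) = ∫⁻ a, (E ∩ V i).indicator 1 a ∂m := fun i =>
    (lintegral_indicator_one (hE.inter (hV i))).symm
  simp_rw [h1]
  rw [← lintegral_finsetSum _ fun i _ => measurable_one.indicator (hE.inter (hV i)),
    ← lintegral_indicator_one hE]
  refine lintegral_congr_ae ?_
  filter_upwards [h] with a ha
  by_cases hEa : a ∈ E
  · obtain ⟨i, hi, hu⟩ := ha hEa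
    rw [Finset.sum_eq_single i]
    · simp [hEa, hi]
    · intro j _ hj
      have : a ∉ V j := fun hVj => hj (hu j hVj)
      simp [this]
    · simp
  · simp [hEa]

/-! ### Cylinders -/

/-- The sequences that agree with `x` on the cells `u, …, v`. -/
def box (u v : ℤ) (x : ℤ → A) : Set (ℤ → A) := {a | ∀ z, u ≤ z → z ≤ v → a z = x z}

/-- Membership in `E` depends only on the cells in `(-∞, n]`. -/
def DetBy (n : ℤ) (E : Set (ℤ → A)) : Prop :=
  ∀ a b : ℤ → A, (∀ z ≤ n, a z = b z) → a ∈ E → b ∈ E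

lemma DetBy.mono {n k : ℤ} {E : Set (ℤ → A)} (h : DetBy n E) (hnk : n ≤ k) : DetBy k E :=
  fun _ _ hab => h _ _ fun z hz => hab z (hz.trans hnk)

lemma DetBy.inter {n : ℤ} {E E' : Set (ℤ → A)} (h : DetBy n E) (h' : DetBy n E') :
    DetBy n (E ∩ E') :=
  fun _ _ hab ha => ⟨h _ _ hab ha.1, h' _ _ hab ha.2⟩

lemma DetBy.mem_iff {n : ℤ} {E : Set (ℤ → A)} (h : DetBy n E) {a b : ℤ → A}
    (hab : ∀ z ≤ n, a z = b z) : a ∈ E ↔ b ∈ E :=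
  ⟨h a b hab, h b a fun z hz => (hab z hz).symm⟩

lemma detBy_box (u v : ℤ) (x : ℤ → A) : DetBy v (box u v x) :=
  fun _ _ hab ha z hu hv => (hab z hv).symm.trans (ha z hu hv)

lemma DetBy.preimage_translate {n : ℤ} {E : Set (ℤ → A)} (h : DetBy n E) (k : ℤ) :
    DetBy (n + k) (translate k ⁻¹' E) :=
  fun _ _ hab ha => h _ _ (fun z hz => hab (z + k) (by omega)) ha

lemma DetBy.preimage_caMap {n : ℤ} {E : Set (ℤ → A)} (h : DetBy n E) (φ : A → A → A → A) :
    DetBy (n + 1) (caMap φ ⁻¹' E) := by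
  intro a b hab ha
  refine h _ _ (fun z hz => ?_) ha
  simp only [caMap]
  rw [hab _ (by omega), hab _ (by omega), hab _ (by omega)]

lemma box_succ {u n : ℤ} (hu : u ≤ n + 1) (x : ℤ → A) :
    box u (n + 1) x = box u n x ∩ {a | a (n + 1) = x (n + 1)} := by
  ext a
  simp only [box, Set.mem_ofPred_eq, Set.mem_inter_iff]
  refine ⟨fun h => ⟨fun z h1 h2 => h z h1 (by omega), h _ hu le_rfl⟩, fun h z h1 h2 => ?_⟩
  rcases Int.le_add_one_iff.1 h2 with h3 | h3
  · exact h.1 z h1 h3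
  · rw [h3]; exact h.2

lemma measurableSet_box [MeasurableSpace A] [MeasurableSingletonClass A] (u v : ℤ)
    (x : ℤ → A) : MeasurableSet (box u v x) := by
  have : box u v x = ⋂ z : ℤ, ⋂ _ : u ≤ z, ⋂ _ : z ≤ v, (fun a : ℤ → A => a z) ⁻¹' {x z} := by
    ext a; simp [box]
  rw [this]
  exact MeasurableSet.iInter fun z => MeasurableSet.iInter fun _ => MeasurableSet.iInter fun _ =>
    measurable_pi_apply z (measurableSet_singleton _)

/-- Finite measures on `A^ℤ` that agree on all sufficiently large symmetric boxes are equal. -/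
lemma measure_ext_of_box [Finite A] [MeasurableSpace A] [MeasurableSingletonClass A]
    {m₁ m₂ : Measure (ℤ → A)} [IsFiniteMeasure m₁] [IsFiniteMeasure m₂] (k₀ : ℤ)
    (h : ∀ k ≥ k₀, ∀ x, m₁ (box (-k) k x) = m₂ (box (-k) k x)) : m₁ = m₂ := by
  have hI : ∀ k ≥ k₀, m₁.map ((Finset.Icc (-k) k).restrict (π := fun _ => A)) =
      m₂.map ((Finset.Icc (-k) k).restrict (π := fun _ => A)) := by
    intro k hk
    refine Measure.ext_of_singleton fun w => ?_
    rw [Measure.map_apply (Finset.measurable_restrict _) (measurableSet_singleton _),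
      Measure.map_apply (Finset.measurable_restrict _) (measurableSet_singleton _)]
    by_cases hne : Nonempty A
    · obtain ⟨a₀⟩ := hne
      have : (Finset.Icc (-k) k).restrict (π := fun _ => A) ⁻¹' {w} =
          box (-k) k (fun z => if hz : z ∈ Finset.Icc (-k) k then w ⟨z, hz⟩ else a₀) := by
        ext a
        simp only [Set.mem_preimage, Set.mem_singleton_iff, box, Set.mem_ofPred_eq]
        constructor
        · rintro rfl z h1 h2
          simp [h1, h2]
        · intro h3
          funext ⟨z, hz⟩
          have := h3 z (Finset.mem_Icc.1 hz).1 (Finset.mem_Icc.1 hz).2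
          simpa [Finset.mem_Icc.1 hz] using this
      rw [this, h k hk]
    · have : IsEmpty (ℤ → A) := ⟨fun a => hne ⟨a 0⟩⟩
      rw [Set.eq_empty_of_isEmpty (_ ⁻¹' _)]
      simp
  have hP : IsProjectiveLimit m₂ fun I : Finset ℤ => m₂.map I.restrict := fun I => rfl
  have hP' : IsProjectiveLimit m₁ fun I : Finset ℤ => m₂.map I.restrict := by
    intro I
    obtain ⟨k, hk, hIk⟩ : ∃ k ≥ k₀, I ⊆ Finset.Icc (-k) k := by
      -- The sum of the absolute values bounds each of them, so the interval of this radius contains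
      -- `I`.
      refine ⟨max k₀ (∑ z ∈ I, |z|), le_max_left _ _, fun z hz => ?_⟩
      have h1 := Finset.single_le_sum (f := fun z : ℤ => |z|) (fun i _ => abs_nonneg i) hz
      have h2 := abs_le.1 (h1.trans (le_max_right k₀ _))
      exact Finset.mem_Icc.2 h2
    have h1 := congrArg (Measure.map (Finset.restrict₂ (π := fun _ => A) hIk)) (hI k hk)
    rwa [Measure.map_map (Finset.measurable_restrict₂ _) (Finset.measurable_restrict _),
      Measure.map_map (Finset.measurable_restrict₂ _) (Finset.measurable_restrict _)] at h1
  exact hP'.unique hP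

/-! ### Measures with uniform transitions -/

/-- From cell `f` on, the measure `m` is carried by sequences with `R`-admissible transitions, and
given the past, all `F` admissible followers of the present letter are equally likely. -/
structure UnifFrom [MeasurableSpace A] (R : Set (ℤ → A)) (F : ℕ) (f : ℤ)
    (m : Measure (ℤ → A)) : Prop where
  adm : ∀ n ≥ f, ∀ᵐ a ∂m, Adm2 R (a n) (a (n + 1))
  unif : ∀ n ≥ f, ∀ E, MeasurableSet E → DetBy n E → ∀ d, (∀ a ∈ E, Adm2 R (a n) d) →
    m (E ∩ {a | a (n + 1) = d}) * F = m E

section UnifFrom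
variable [Finite A] [MeasurableSpace A] [MeasurableSingletonClass A]
  {R : Set (ℤ → A)} {F : ℕ} {f : ℤ} {m : Measure (ℤ → A)}

lemma UnifFrom.mono (h : UnifFrom R F f m) {f' : ℤ} (hf : f ≤ f') : UnifFrom R F f' m :=
  ⟨fun n hn => h.adm n (hf.trans hn), fun n hn => h.unif n (hf.trans hn)⟩

/-- Conditioning on a past event merely replaces the test event `E` by `E ∩ X`, which is still
determined by the past. -/
lemma UnifFrom.restrict (h : UnifFrom R F f m) {X : Set (ℤ → A)} (hX : MeasurableSet X)
    (hXf : DetBy f X) : UnifFrom R F f (m.restrict X) := by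
  refine ⟨fun n hn => ae_restrict_of_ae (h.adm n hn), fun n hn E hE hEn d hd => ?_⟩
  rw [Measure.restrict_apply hE,
    Measure.restrict_apply (hE.inter (measurableSet_coord (· = d) (n + 1))), Set.inter_right_comm]
  exact h.unif n hn _ (hE.inter hX) (hEn.inter (hXf.mono hn)) d fun a ha => hd a ha.1

lemma UnifFrom.smul (h : UnifFrom R F f m) (c : ENNReal) : UnifFrom R F f (c • m) := by
  refine ⟨fun n hn => Measure.ae_smul_measure (h.adm n hn) c, fun n hn E hE hEn d hd => ?_⟩
  simp only [Measure.smul_apply, smul_eq_mul]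
  rw [mul_assoc, h.unif n hn E hE hEn d hd]

lemma UnifFrom.finsetSum {ι : Type*} {s : Finset ι} {m : ι → Measure (ℤ → A)}
    (h : ∀ i ∈ s, UnifFrom R F f (m i)) : UnifFrom R F f (∑ i ∈ s, m i) := by
  refine ⟨fun n hn => ?_, fun n hn E hE hEn d hd => ?_⟩
  · rw [ae_iff, Measure.finsetSum_apply]
    exact Finset.sum_eq_zero fun i hi => ae_iff.1 ((h i hi).adm n hn)
  · simp only [Measure.finsetSum_apply, Finset.sum_mul]
    exact Finset.sum_congr rfl fun i hi => (h i hi).unif n hn E hE hEn d hd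

lemma UnifFrom.map_translate (h : UnifFrom R F f m) (k : ℤ) :
    UnifFrom R F (f - k) (m.map (translate k)) := by
  refine ⟨fun n hn => ?_, fun n hn E hE hEn d hd => ?_⟩
  · rw [ae_map_iff (measurable_translate k).aemeasurable (measurableSet_coord₂ (Adm2 R) _ _)]
    filter_upwards [h.adm (n + k) (by omega)] with a ha
    simpa [add_right_comm] using ha
  · rw [Measure.map_apply (measurable_translate k) hE, Measure.map_apply (measurable_translate k)
      (hE.inter (measurableSet_coord (· = d) (n + 1)))]
    have := h.unif (n + k) (by omega) _ (measurable_translate k hE) (hEn.preimage_translate k) d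
      (fun a ha => hd _ ha)
    rw [← this]
    simp [Set.preimage_inter, add_right_comm]

/-- The law with uniform transitions is determined by the past. -/
lemma UnifFrom.unique (hF : F ≠ 0) {m₁ m₂ : Measure (ℤ → A)} [IsProbabilityMeasure m₁]
    [IsProbabilityMeasure m₂] (h₁ : UnifFrom R F f m₁) (h₂ : UnifFrom R F f m₂) {c : ℤ → A}
    (hc₁ : ∀ᵐ a ∂m₁, ∀ z ≤ f, a z = c z) (hc₂ : ∀ᵐ a ∂m₂, ∀ z ≤ f, a z = c z) : m₁ = m₂ := by
  classical
  -- Induction on the right end of the box. At `f` the cells are deterministic, so both measures are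
  -- 0 or 1 together; each further cell multiplies both by `1 / F`, or makes both vanish if the
  -- transition is inadmissible.
  have key : ∀ n ≥ f, ∀ u ≤ n, ∀ x, u ≤ f → m₁ (box u n x) = m₂ (box u n x) := by
    intro n hn
    induction n, hn using Int.leInduction with
    | base =>
      intro u hu x _
      have aux : ∀ m : Measure (ℤ → A), IsProbabilityMeasure m →
          (∀ᵐ a ∂m, ∀ z ≤ f, a z = c z) → m (box u f x) = if c ∈ box u f x then 1 else 0 := by
        intro m _ hm
        have hiff : ∀ᵐ a ∂m, (a ∈ box u f x ↔ c ∈ box u f x) := by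
          filter_upwards [hm] with a ha using (detBy_box u f x).mem_iff ha
        split_ifs with hcx
        · refine (mem_ae_iff_prob_eq_one (measurableSet_box u f x)).1 ?_
          filter_upwards [hiff] with a ha using ha.2 hcx
        · refine measure_eq_zero_iff_ae_notMem.2 ?_
          filter_upwards [hiff] with a ha using fun h => hcx (ha.1 h)
      rw [aux m₁ inferInstance hc₁, aux m₂ inferInstance hc₂]
    | succ n hn ih =>
      intro u hu x huf
      rw [box_succ hu]
      by_cases hadm : Adm2 R (x n) (x (n + 1))
      · have hx : ∀ a ∈ box u n x, Adm2 R (a n) (x (n + 1)) := fun a ha => by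
          rw [ha n (huf.trans hn) le_rfl]; exact hadm
        have e₁ := h₁.unif n hn _ (measurableSet_box u n x) (detBy_box u n x) _ hx
        have e₂ := h₂.unif n hn _ (measurableSet_box u n x) (detBy_box u n x) _ hx
        rw [ih u (huf.trans hn) x huf, ← e₂] at e₁
        exact (ENNReal.mul_left_inj (by exact_mod_cast hF) (ENNReal.natCast_ne_top F)).1 e₁
      · have aux : ∀ m, UnifFrom R F f m →
            m (box u n x ∩ {a | a (n + 1) = x (n + 1)}) = 0 := by
          intro m hm
          refine measure_eq_zero_iff_ae_notMem.2 ?_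
          filter_upwards [hm.adm n hn] with a ha hax
          rw [hax.1 n (huf.trans hn) le_rfl, hax.2] at ha
          exact hadm ha
        rw [aux m₁ h₁, aux m₂ h₂]
  refine measure_ext_of_box |f| fun k hk x => ?_
  have := abs_le.1 hk
  exact key k this.2 (-k) (by have := abs_nonneg f; omega) x this.1

/-- Uniformity of the transitions can be checked on cylinders. -/
lemma UnifFrom.of_box [IsFiniteMeasure m]
    (hadm : ∀ n ≥ f, ∀ᵐ a ∂m, Adm2 R (a n) (a (n + 1)))
    (hbox : ∀ n ≥ f, ∀ u ≤ n, ∀ x, Adm2 R (x n) (x (n + 1)) →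
      m (box u (n + 1) x) * F = m (box u n x)) : UnifFrom R F f m := by
  refine ⟨hadm, fun n hn E hE hEn d hd => ?_⟩
  -- Freezing all cells beyond `n` at the value of cell `n` leaves `E` unchanged. It therefore
  -- suffices to compare the image measures under `tr`, and those can be compared on symmetric
  -- boxes.
  set tr : (ℤ → A) → (ℤ → A) := fun a z => a (min z n)
  have htr : Measurable tr := measurable_pi_lambda _ fun z => measurable_pi_apply _
  have htrE : tr ⁻¹' E = E := by
    ext a
    exact hEn.mem_iff fun z hz => by simp [tr, hz]
  have key : ((F : ENNReal) • m.restrict ({a | Adm2 R (a n) d} ∩ {a | a (n + 1) = d})).map tr =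
      (m.restrict {a | Adm2 R (a n) d}).map tr := by
    have : IsFiniteMeasure
        ((F : ENNReal) • m.restrict ({a | Adm2 R (a n) d} ∩ {a | a (n + 1) = d})) :=
      Measure.smul_finite _ (ENNReal.natCast_ne_top F)
    refine measure_ext_of_box |n| fun k hk x => ?_
    have hk' := abs_le.1 hk
    rw [Measure.map_apply htr (measurableSet_box _ _ _),
      Measure.map_apply htr (measurableSet_box _ _ _), Measure.smul_apply,
      Measure.restrict_apply (htr (measurableSet_box _ _ _)),
      Measure.restrict_apply (htr (measurableSet_box _ _ _)), smul_eq_mul, mul_comm]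
    -- The pulled-back box is a box ending at `n` when `x` is constant on `[n, k]`, and is empty
    -- otherwise.
    by_cases hx : Adm2 R (x n) d ∧ ∀ z, n ≤ z → z ≤ k → x z = x n
    · have hpre : tr ⁻¹' box (-k) k x = box (-k) n x := by
        ext a
        simp only [box, Set.mem_preimage, Set.mem_ofPred_eq, tr]
        refine ⟨fun h z h1 h2 => ?_, fun h z h1 h2 => ?_⟩
        · simpa [h2] using h z h1 (h2.trans hk'.2)
        · rcases le_total z n with h3 | h3
          · simpa [h3] using h z h1 h3
          · simpa [h3, hx.2 z h3 h2] using h n hk'.1 le_rfl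
      set y : ℤ → A := fun z => if z ≤ n then x z else d
      have hy : box (-k) n x = box (-k) n y := by
        ext a
        exact forall_congr' fun z => forall_congr' fun _ => forall_congr' fun h => by simp [y, h]
      have h1 := hbox n hn (-k) hk'.1 y (by simpa [y] using hx.1)
      rw [box_succ (by omega)] at h1
      have e1 : box (-k) n y ∩ {a | Adm2 R (a n) d} = box (-k) n y := by
        refine Set.inter_eq_left.2 fun a ha => ?_
        have := ha n hk'.1 le_rfl
        simp only [Set.mem_ofPred_eq, this]
        simpa [y] using hx.1
      have e2 : box (-k) n y ∩ ({a | Adm2 R (a n) d} ∩ {a | a (n + 1) = d}) =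
          box (-k) n y ∩ {a | a (n + 1) = y (n + 1)} := by
        rw [← Set.inter_assoc, e1]
        simp [y]
      rw [hpre, hy, e1, e2, h1]
    · have hempty : tr ⁻¹' box (-k) k x ∩ {a | Adm2 R (a n) d} = ∅ := by
        refine Set.eq_empty_of_forall_notMem fun a ha => hx ?_
        have h0 := ha.1 n hk'.1 hk'.2
        simp only [tr, min_self] at h0
        refine ⟨h0 ▸ ha.2, fun z h1 h2 => ?_⟩
        have h3 := ha.1 z (hk'.1.trans h1) h2
        simp only [tr, min_eq_right h1] at h3
        rw [← h3, h0]
      rw [hempty, ← Set.inter_assoc, hempty]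
      simp
  have h2 := congrArg (fun ν => ν E) key
  simp only [Measure.map_apply htr hE, htrE, Measure.smul_apply, Measure.restrict_apply hE,
    smul_eq_mul] at h2
  have e1 : E ∩ {a | Adm2 R (a n) d} = E := Set.inter_eq_left.2 fun a ha => hd a ha
  rw [← Set.inter_assoc, e1] at h2
  rw [mul_comm]; exact h2

end UnifFrom

/-! ### Uniform transitions are preserved by right-resolving cellular automata -/

/-- For a right-resolving cellular automaton on a right-regular Markov subshift, the new letter
determines the old one, and every admissible new letter occurs. -/
lemma IsRightResolving.existsUnique [Finite A] [TopologicalSpace A] {R : Set (ℤ → A)}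
    {φ : A → A → A → A} (hres : IsRightResolving φ R) (hR : IsMarkovSubshift R) {F : ℕ}
    (hF : ∀ b, Adm1 R b → (follSet R b).ncard = F) {a b c d : A}
    (hab : Adm2 R a b) (hbc : Adm2 R b c) (hd : Adm2 R (φ a b c) d) :
    ∃! e, Adm2 R c e ∧ φ b c e = d := by
  have hinj := hres.2 a b c (hR.adm3 hab hbc)
  have hmaps : (fun e => φ b c e) '' follSet R c ⊆ follSet R (φ a b c) := by
    rintro _ ⟨e, he, rfl⟩
    exact hR.adm2_rule hres.1 hab hbc he
  have heq := Set.eq_of_subset_of_ncard_le hmaps (by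
    rw [hinj.ncard_image, hF _ (hbc.right hR.1.2), hF _ hd.left])
  have hd' : d ∈ follSet R (φ a b c) := hd
  rw [← heq] at hd'
  obtain ⟨e, he, hed⟩ := hd'
  exact ⟨e, ⟨he, hed⟩, fun e' he' => hinj he'.1 he (he'.2.trans hed.symm)⟩

section
variable [Finite A] [TopologicalSpace A] [MeasurableSpace A] [MeasurableSingletonClass A]
  {R : Set (ℤ → A)} {F : ℕ} {f g : ℤ} {m : Measure (ℤ → A)} {φ : A → A → A → A}

/-- The image cell `n + 1` is a function of cells `n`, `n + 1`, `n + 2`, and the image up to `n`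
depends on cells up to `n + 1` only. Given these, cell `n + 2` is uniform on `F` followers, which
the rule carries bijectively to the followers of the image letter. Since cell `n + 2` drives image
cell `n + 1`, the threshold drops by one. -/
lemma UnifFrom.map_caMap (hR : IsMarkovSubshift R) (hres : IsRightResolving φ R)
    (hF : ∀ b, Adm1 R b → (follSet R b).ncard = F) (hg : g + 2 ≤ f)
    (hadm : ∀ᵐ a ∂m, ∀ z ≥ g, Adm2 R (a z) (a (z + 1))) (h : UnifFrom R F f m) :
    UnifFrom R F (f - 1) (m.map (caMap φ)) := by
  cases nonempty_fintype A
  refine ⟨fun n hn => ?_, fun n hn E hE hEn d hd => ?_⟩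
  · rw [ae_map_iff (measurable_caMap φ).aemeasurable (measurableSet_coord₂ (Adm2 R) _ _)]
    filter_upwards [hadm] with a ha
    exact hR.adm2_caMap hres.1 fun j h1 _ => ha j (by omega)
  · have hE' := measurable_caMap φ hE
    have hEn' := hEn.preimage_caMap φ
    have hd1 : MeasurableSet {a : ℤ → A | a (n + 1) = d} := measurableSet_coord (· = d) (n + 1)
    rw [Measure.map_apply (measurable_caMap φ) hE, Measure.map_apply (measurable_caMap φ)
      (hE.inter hd1), Set.preimage_inter]
    -- `V e` says that `e` is the letter at cell `n + 2` that would produce `d`. It depends only on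
    -- cells `n` and `n + 1`, so it can be added to the past event.
    set V : A → Set (ℤ → A) :=
      fun e => {a | Adm2 R (a (n + 1)) e ∧ φ (a n) (a (n + 1)) e = d} with hVdef
    have hV : ∀ e, MeasurableSet (V e) := fun e =>
      measurableSet_coord₂ (fun x y => Adm2 R y e ∧ φ x y e = d) n (n + 1)
    have hu : ∀ᵐ a ∂m, a ∈ caMap φ ⁻¹' E → ∃! e, a ∈ V e := by
      filter_upwards [hadm] with a ha haE
      have h1 := ha (n - 1) (by omega)
      rw [sub_add_cancel] at h1
      exact hres.existsUnique hR hF h1 (ha n (by omega)) (hd _ haE)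
    have e1 := measure_eq_sum_of_existsUnique hE' hV hu
    have e2 : m (caMap φ ⁻¹' E ∩ caMap φ ⁻¹' {a | a (n + 1) = d}) =
        ∑ e, m (caMap φ ⁻¹' E ∩ V e ∩ {a | a (n + 1 + 1) = e}) := by
      rw [measure_eq_sum_of_existsUnique (hE'.inter (measurable_caMap φ hd1)) hV
        (hu.mono fun a ha haE => ha haE.1)]
      refine Finset.sum_congr rfl fun e _ => measure_congr ?_
      filter_upwards [hu, hadm] with a ha hadm
      refine propext ⟨fun h3 => ⟨⟨h3.1.1, h3.2⟩, ?_⟩, fun h3 => ⟨⟨h3.1.1, ?_⟩, h3.1.2⟩⟩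
      · refine (ha h3.1.1).unique (y₁ := a (n + 1 + 1)) (y₂ := e) ?_ h3.2
        have h4 : caMap φ a (n + 1) = d := h3.1.2
        simp only [caMap, add_sub_cancel_right] at h4
        exact ⟨hadm _ (by omega), h4⟩
      · have h4 : φ (a n) (a (n + 1)) e = d := h3.1.2.2
        have h5 : a (n + 1 + 1) = e := h3.2
        change caMap φ a (n + 1) = d
        simp only [caMap, add_sub_cancel_right, h5, h4]
    rw [e1, e2, Finset.sum_mul]
    refine Finset.sum_congr rfl fun e _ => ?_
    refine h.unif (n + 1) (by omega) _ (hE'.inter (hV e)) (hEn'.inter ?_) e fun a ha => ha.2.1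
    intro a b hab ha
    have h1 := hab (n + 1) le_rfl
    have h2 := hab n (by omega)
    simpa [hVdef, h1, h2] using ha

/-- Each step lowers the uniformity threshold by one and raises the start of the admissible region
by one, so the gap of at least 2 needed for every step costs `2 * p` in total. -/
lemma UnifFrom.map_iterate_caMap (hR : IsMarkovSubshift R) (hres : IsRightResolving φ R)
    (hF : ∀ b, Adm1 R b → (follSet R b).ncard = F) (p : ℕ) (hg : g + 2 * p ≤ f)
    (hadm : ∀ᵐ a ∂m, ∀ z ≥ g, Adm2 R (a z) (a (z + 1))) (h : UnifFrom R F f m) :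
    UnifFrom R F (f - p) (m.map (caMap φ)^[p]) := by
  induction p generalizing f g m with
  | zero => simpa using h
  | succ p ih =>
    have h1 := h.map_caMap hR hres hF (by push_cast at hg; omega) hadm
    rw [Function.iterate_succ, ← Measure.map_map ((measurable_caMap φ).iterate p)
      (measurable_caMap φ)]
    have := ih (f := f - 1) (g := g + 1) (by push_cast at hg; omega) ?_ h1
    · convert this using 1
      push_cast; ring
    · rw [ae_map_iff (measurable_caMap φ).aemeasurable]
      · filter_upwards [hadm] with a ha z hz
        exact hR.adm2_caMap hres.1 fun j h1 _ => ha j (by omega)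
      · have : {a : ℤ → A | ∀ z ≥ g + 1, Adm2 R (a z) (a (z + 1))} =
            ⋂ z : ℤ, ⋂ _ : z ≥ g + 1, {a | Adm2 R (a z) (a (z + 1))} := by
          ext a; simp
        rw [this]
        exact MeasurableSet.iInter fun z => MeasurableSet.iInter fun _ =>
          measurableSet_coord₂ (Adm2 R) _ _

end

/-! ### Markov chains from deterministic dynamics -/

/-- If the restriction of `map T (P s)` to each fibre of `X` is a multiple of the reference measure
of this fibre, then the observations `X, X ∘ T, X ∘ T², …` form a Markov chain. -/
lemma isMarkovMeasure_of_fibre {Ω 𝒳 : Type*} [MeasurableSpace Ω] [Fintype 𝒳] [MeasurableSpace 𝒳]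
    [MeasurableSingletonClass 𝒳] (X : Ω → 𝒳) (T : Ω → Ω) (hX : Measurable X) (hT : Measurable T)
    (P : 𝒳 → Measure Ω) (hP : ∀ s, P s = 0 ∨ IsProbabilityMeasure (P s))
    (hTP : ∀ s s', ((P s).map T).restrict (X ⁻¹' {s'}) = ((P s).map T) (X ⁻¹' {s'}) • P s')
    (μ : Measure Ω) [IsProbabilityMeasure μ]
    (hμ : ∀ s, μ.restrict (X ⁻¹' {s}) = μ (X ⁻¹' {s}) • P s) :
    IsMarkovMeasure (μ.map fun ω n => X (T^[n] ω)) := by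
  classical
  have hXm : ∀ s, MeasurableSet (X ⁻¹' {s}) := fun s => hX (measurableSet_singleton s)
  have hsum : ∀ (ν : Measure Ω) [IsProbabilityMeasure ν], ∑ s, ν (X ⁻¹' {s}) = 1 := by
    intro ν _
    rw [← measure_univ (μ := ν), measure_eq_sum_of_existsUnique MeasurableSet.univ hXm
      (Eventually.of_forall fun ω _ => ⟨X ω, rfl, fun _ h => h.symm⟩)]
    simp
  have hTprob : ∀ s, P s ≠ 0 → IsProbabilityMeasure ((P s).map T) := fun s hs => by
    have := (hP s).resolve_left hs
    exact Measure.isProbabilityMeasure_map hT.aemeasurable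
  set π : PMF 𝒳 := PMF.ofFintype (fun s => μ (X ⁻¹' {s})) (hsum μ)
  set τ : 𝒳 → PMF 𝒳 := fun s =>
    if hs : P s = 0 then PMF.pure s
    else PMF.ofFintype (fun s' => ((P s).map T) (X ⁻¹' {s'}))
      (by have := hTprob s hs; exact hsum _) with hτ
  have hτP : ∀ s s', ((P s).map T).restrict (X ⁻¹' {s'}) = (P s Set.univ * τ s s') • P s' := by
    intro s s'
    rw [hTP]
    by_cases hs : P s = 0
    · simp [hs]
    · have := (hP s).resolve_left hs
      simp [hτ, hs]
  have hzero : ∀ s s', P s ≠ 0 → P s' = 0 → τ s s' = 0 := by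
    intro s s' hs hs'
    have := hTP s s'
    rw [hs', smul_zero, Measure.restrict_eq_zero] at this
    simp [hτ, hs, this]
  have hPuniv : ∀ s, P s ≠ 0 → P s Set.univ = 1 := fun s hs => by
    have := (hP s).resolve_left hs
    exact measure_univ
  refine ⟨π, τ, fun n c => ?_⟩
  have hXT : Measurable fun ω n => X (T^[n] ω) :=
    measurable_pi_lambda _ fun n => hX.comp (hT.iterate n)
  have hcyl : ∀ n, MeasurableSet {ω | ∀ i ≤ n, X (T^[i] ω) = c i} := fun n => by
    have : {ω | ∀ i ≤ n, X (T^[i] ω) = c i} = ⋂ i, ⋂ _ : i ≤ n, T^[i] ⁻¹' (X ⁻¹' {c i}) := by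
      ext; simp
    rw [this]
    exact MeasurableSet.iInter fun i => MeasurableSet.iInter fun _ => hT.iterate i (hXm _)
  have hcyl' : MeasurableSet {x : ℕ → 𝒳 | ∀ i ≤ n, x i = c i} := by
    have : {x : ℕ → 𝒳 | ∀ i ≤ n, x i = c i} =
        ⋂ i, ⋂ _ : i ≤ n, (fun x : ℕ → 𝒳 => x i) ⁻¹' {c i} := by
      ext; simp
    rw [this]
    exact MeasurableSet.iInter fun i => MeasurableSet.iInter fun _ =>
      measurable_pi_apply i (measurableSet_singleton _)
  rw [Measure.map_apply hXT hcyl']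
  set w : ℕ → ENNReal := fun n => π (c 0) * ∏ i ∈ Finset.range n, τ (c i) (c (i + 1)) with hw
  -- The Markov property at the level of measures: the part of `μ` with prescribed observations,
  -- moved forward by `T^[n]`, is a multiple of the reference measure of the last state. The second
  -- conjunct is needed because a zero reference measure says nothing about its coefficient.
  have key : ∀ n, (μ.restrict {ω | ∀ i ≤ n, X (T^[i] ω) = c i}).map T^[n] = w n • P (c n) ∧
      (P (c n) = 0 → w n = 0) := by
    intro n
    induction n with
    | zero =>
      have h0 : {ω | ∀ i ≤ 0, X (T^[i] ω) = c i} = X ⁻¹' {c 0} := by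
        ext; simp
      refine ⟨by rw [h0, hμ]; simp [hw, π], fun h => ?_⟩
      have := hμ (c 0)
      rw [h, smul_zero, Measure.restrict_eq_zero] at this
      simp [hw, π, this]
    | succ n ih =>
      have hset : {ω | ∀ i ≤ n + 1, X (T^[i] ω) = c i} =
          {ω | ∀ i ≤ n, X (T^[i] ω) = c i} ∩ T^[n + 1] ⁻¹' (X ⁻¹' {c (n + 1)}) := by
        ext ω
        constructor
        · exact fun h => ⟨fun i hi => h i (by omega), h _ le_rfl⟩
        · rintro ⟨h1, h2⟩ i hi
          rcases Nat.le_succ_iff.1 hi with h | rfl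
          · exact h1 i h
          · exact h2
      have hws : w (n + 1) = w n * τ (c n) (c (n + 1)) := by
        simp only [hw, Finset.prod_range_succ, mul_assoc]
      constructor
      · rw [hset, Set.inter_comm, ← Measure.restrict_restrict (hT.iterate (n + 1) (hXm _)),
          ← Measure.restrict_map (hT.iterate (n + 1)) (hXm _), Function.iterate_succ',
          ← Measure.map_map hT (hT.iterate n), ih.1, Measure.map_smul, Measure.restrict_smul,
          hτP, smul_smul, hws]
        by_cases h0 : P (c n) = 0
        · simp [ih.2 h0]
        · simp [hPuniv _ h0]
      · intro h0
        rw [hws]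
        by_cases h1 : P (c n) = 0
        · simp [ih.2 h1]
        · simp [hzero _ _ h1 h0]
  have h1 := congrArg (fun ν => ν Set.univ) (key n).1
  simp only [Measure.map_apply (hT.iterate n) MeasurableSet.univ, Set.preimage_univ,
    Measure.restrict_apply_univ, Measure.smul_apply, smul_eq_mul] at h1
  by_cases h0 : P (c n) = 0
  · have h2 := (key n).2 h0
    simp only [h2, zero_mul] at h1
    exact h1.trans h2.symm
  · rw [hPuniv _ h0, mul_one] at h1
    exact h1

/-- Used to relabel the window contents by `Fin N`, the form of state space that `IsHiddenMarkov`
asks for. -/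
lemma IsMarkovMeasure.map_equiv {X Y : Type*} [MeasurableSpace X] [MeasurableSpace Y]
    {m : Measure (ℕ → X)} (hm : IsMarkovMeasure m) (e : X ≃ᵐ Y) :
    IsMarkovMeasure (m.map fun x n => e (x n)) := by
  obtain ⟨π, τ, h⟩ := hm
  refine ⟨π.map e, fun y => (τ (e.symm y)).map e, fun n c => ?_⟩
  have he : Measurable fun (x : ℕ → X) n => e (x n) := by fun_prop
  have hmap : ∀ (ρ : PMF X) y, ρ.map e y = ρ (e.symm y) := by
    intro ρ y
    rw [PMF.map_apply, tsum_eq_single (e.symm y)]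
    · simp
    · intro x hx
      rw [if_neg]
      rintro rfl
      simp at hx
  have h1 := h n fun i => e.symm (c i)
  simp only [hmap]
  rw [← h1]
  have h2 : (MeasurableEquiv.piCongrRight fun _ : ℕ => e) = (fun (x : ℕ → X) n => e (x n)) := rfl
  rw [← h2, MeasurableEquiv.map_apply]
  congr 1
  ext x
  exact forall₂_congr fun i _ => (e.toEquiv.eq_symm_apply).symm

/-! ### Defects under translation and under the cellular automaton -/

lemma mem_defectSet_translate {S : Set (ℤ → A)} {a : ℤ → A} {k j : ℤ} :
    j ∈ defectSet S (translate k a) ↔ j + k ∈ defectSet S a := by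
  simp [defectSet, add_right_comm]

lemma mem_defectSet_congr {S : Set (ℤ → A)} {a b : ℤ → A} {j : ℤ} (h0 : a j = b j)
    (h1 : a (j + 1) = b (j + 1)) : j ∈ defectSet S a ↔ j ∈ defectSet S b := by
  simp [defectSet, h0, h1]

/-- Agreement of the cells only compares transitions up to `n`; beyond that, both sequences must be
known to be free of defects. -/
lemma defectSet_congr {S : Set (ℤ → A)} {a b : ℤ → A} {n : ℤ} (h : ∀ z ≤ n + 1, a z = b z)
    (ha : ∀ j ∈ defectSet S a, j ≤ n) (hb : ∀ j ∈ defectSet S b, j ≤ n) :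
    defectSet S a = defectSet S b := by
  ext j
  refine ⟨fun hj => ?_, fun hj => ?_⟩
  · have := ha j hj
    exact (mem_defectSet_congr (h j (by omega)) (h (j + 1) (by omega))).1 hj
  · have := hb j hj
    exact (mem_defectSet_congr (h j (by omega)) (h (j + 1) (by omega))).2 hj

/-- Defects propagate with speed at most one. -/
lemma bounds_defectSet_iterate [TopologicalSpace A] {S : Set (ℤ → A)} (hS : IsMarkovSubshift S)
    {φ : A → A → A → A} (hφ : Set.MapsTo (caMap φ) S S) {a : ℤ → A} {u v : ℤ}
    (h : ∀ j ∈ defectSet S a, u ≤ j ∧ j ≤ v) (t : ℕ) :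
    ∀ j ∈ defectSet S ((caMap φ)^[t] a), u - t ≤ j ∧ j ≤ v + t := by
  induction t with
  | zero => simpa using h
  | succ t ih =>
    intro j hj
    rw [Function.iterate_succ_apply'] at hj
    by_contra hcon
    refine hj (hS.adm2_caMap hφ fun i h1 h2 => ?_)
    by_contra hi
    have := ih i hi
    push_cast at hcon
    omega

/-- The leftmost defect of `a` is at `l`, all defects are within distance `K` of it, `a` is
`q`-periodic to the left of the defects and `R`-admissible to their right. -/
structure IsLocalized (S R : Set (ℤ → A)) (q : ℕ) (K : ℤ) (l : ℤ) (a : ℤ → A) : Prop where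
  isLeast : IsLeast (defectSet S a) l
  le : ∀ j ∈ defectSet S a, j ≤ l + K
  periodic : ∀ z ≤ l - K, a (z - q) = a z
  adm : ∀ z ≥ l + K, Adm2 R (a z) (a (z + 1))

/-- A persistent localized defect. -/
def IsParticle (φ : A → A → A → A) (S R : Set (ℤ → A)) (q : ℕ) (K : ℤ) (a : ℤ → A) : Prop :=
  ∀ t : ℕ, ∃ l, IsLocalized S R q K l ((caMap φ)^[t] a)

section
variable {φ : A → A → A → A} {S R : Set (ℤ → A)} {q : ℕ} {K l : ℤ} {a b : ℤ → A}

lemma IsLocalized.defectLeft_eq (h : IsLocalized S R q K l a) : defectLeft S a = l :=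
  h.isLeast.csInf_eq

lemma IsLocalized.isGreatest (h : IsLocalized S R q K l a) :
    IsGreatest (defectSet S a) (defectRight S a) :=
  ⟨Int.csSup_mem ⟨l, h.isLeast.1⟩ ⟨l + K, h.le⟩, fun _ hj => le_csSup ⟨l + K, h.le⟩ hj⟩

lemma IsLocalized.translate (h : IsLocalized S R q K l a) (k : ℤ) :
    IsLocalized S R q K (l - k) (translate k a) := by
  refine ⟨⟨?_, fun j hj => ?_⟩, fun j hj => ?_, fun z hz => ?_, fun z hz => ?_⟩
  · rw [mem_defectSet_translate, sub_add_cancel]; exact h.isLeast.1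
  · have := h.isLeast.2 (mem_defectSet_translate.1 hj); omega
  · have := h.le _ (mem_defectSet_translate.1 hj); omega
  · have := h.periodic (z + k) (by omega)
    simpa [sub_add_eq_add_sub] using this
  · have := h.adm (z + k) (by omega)
    simpa [add_right_comm] using this

lemma IsLocalized.defectRight_translate (h : IsLocalized S R q K l a) (k : ℤ) :
    defectRight S (DefectWalk.translate k a) = defectRight S a - k := by
  have h1 := h.isGreatest
  have h2 := (h.translate k).isGreatest
  refine le_antisymm ?_ ?_
  · have := h1.2 (mem_defectSet_translate.1 h2.1); omega
  · exact h2.2 (mem_defectSet_translate.2 (by simpa using h1.1))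

lemma IsLocalized.defectWidth_translate (h : IsLocalized S R q K l a) (k : ℤ) :
    defectWidth S (DefectWalk.translate k a) = defectWidth S a := by
  rw [defectWidth, defectWidth, h.defectRight_translate, (h.translate k).defectLeft_eq,
    h.defectLeft_eq]
  ring

lemma IsParticle.isLocalized (h : IsParticle φ S R q K a) (t : ℕ) :
    IsLocalized S R q K (defectLeft S ((caMap φ)^[t] a)) ((caMap φ)^[t] a) := by
  obtain ⟨l, hl⟩ := h t
  rwa [hl.defectLeft_eq]

lemma IsParticle.iterate (h : IsParticle φ S R q K a) (t : ℕ) :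
    IsParticle φ S R q K ((caMap φ)^[t] a) := by
  intro s
  rw [← Function.iterate_add_apply]
  exact h (s + t)

lemma IsParticle.translate (h : IsParticle φ S R q K a) (k : ℤ) :
    IsParticle φ S R q K (translate k a) := by
  intro t
  rw [iterate_caMap_translate]
  exact ⟨_, (h.isLocalized t).translate k⟩

/-- The sequence, recentred at its leftmost defect. -/
def recenter (S : Set (ℤ → A)) (a : ℤ → A) : ℤ → A := translate (defectLeft S a) a

lemma IsParticle.recenter (h : IsParticle φ S R q K a) :
    IsParticle φ S R q K (recenter S a) ∧ defectLeft S (recenter S a) = 0 := by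
  refine ⟨h.translate _, ?_⟩
  have := ((h.isLocalized 0).translate (defectLeft S a)).defectLeft_eq
  simpa [DefectWalk.recenter] using this

/-- The automaton commutes with translations, so an earlier recentring is absorbed by a later one.
Iterating "evolve and recentre" thus amounts to evolving and recentring once at the end. -/
lemma IsParticle.recenter_iterate_recenter (h : IsParticle φ S R q K a) (t : ℕ) :
    DefectWalk.recenter S ((caMap φ)^[t] (DefectWalk.recenter S a)) =
      DefectWalk.recenter S ((caMap φ)^[t] a) := by
  rw [DefectWalk.recenter, DefectWalk.recenter, iterate_caMap_translate,
    ((h.isLocalized t).translate _).defectLeft_eq, translate_translate, sub_add_cancel,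
    DefectWalk.recenter]

/-- The cells of a localized sequence in a large window determine all cells to its left. -/
lemma IsLocalized.eq_of_window (hq : 0 < q) {M N : ℤ} (hM : K + q ≤ M) (hN : -K ≤ N)
    (ha : IsLocalized S R q K 0 a) (hb : IsLocalized S R q K 0 b)
    (h : ∀ z, -M ≤ z → z ≤ N → a z = b z) : ∀ z ≤ N, a z = b z := by
  -- Periodicity extends the agreement to the left one cell at a time. The bound `K + q ≤ M` puts `z
  -- + q` inside the periodic region whenever `z` lies left of the window.
  have key : ∀ k : ℕ, ∀ z, -M - k ≤ z → z ≤ N → a z = b z := by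
    intro k
    induction k with
    | zero => simpa using h
    | succ k ih =>
      intro z h1 h2
      push_cast at h1
      by_cases h3 : -M ≤ z
      · exact h z h3 h2
      have e1 := ha.periodic (z + q) (by omega)
      have e2 := hb.periodic (z + q) (by omega)
      rw [add_sub_cancel_right] at e1 e2
      rw [e1, e2, ih _ (by omega) (by omega)]
  intro z hz
  exact key (-M - z).toNat z (by omega) hz

end

/-! ### Measurability of particles and of recentring. -/

section Measurability
variable [Finite A] [MeasurableSpace A] [MeasurableSingletonClass A]

lemma measurable_mem_defectSet (S : Set (ℤ → A)) (j : ℤ) :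
    Measurable fun a : ℤ → A => j ∈ defectSet S a :=
  measurableSet_setOfPred.1 (measurableSet_coord₂ (fun x y => ¬ Adm2 S x y) j (j + 1))

lemma measurable_isLeast_defectSet (S : Set (ℤ → A)) (l : ℤ) :
    Measurable fun a : ℤ → A => IsLeast (defectSet S a) l :=
  (measurable_mem_defectSet S l).and
    (Measurable.forall fun j => (measurable_mem_defectSet S j).imp measurable_const)

lemma measurable_isLocalized (S R : Set (ℤ → A)) (q : ℕ) (K l : ℤ) :
    Measurable fun a : ℤ → A => IsLocalized S R q K l a := by
  have : (fun a : ℤ → A => IsLocalized S R q K l a) = fun a => IsLeast (defectSet S a) l ∧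
      (∀ j, j ∈ defectSet S a → j ≤ l + K) ∧ (∀ z, z ≤ l - K → a (z - q) = a z) ∧
      ∀ z, z ≥ l + K → Adm2 R (a z) (a (z + 1)) := by
    funext a
    exact propext ⟨fun h => ⟨h.1, h.2, h.3, h.4⟩, fun h => ⟨h.1, h.2.1, h.2.2.1, h.2.2.2⟩⟩
  rw [this]
  refine (measurable_isLeast_defectSet S l).and (Measurable.and ?_ (Measurable.and ?_ ?_))
  · exact Measurable.forall fun j => (measurable_mem_defectSet S j).imp measurable_const
  · exact Measurable.forall fun z => measurable_const.imp
      (measurableSet_setOfPred.1 (measurableSet_coord₂ (· = ·) _ _))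
  · exact Measurable.forall fun z => measurable_const.imp
      (measurableSet_setOfPred.1 (measurableSet_coord₂ (Adm2 R) _ _))

lemma measurable_isParticle (φ : A → A → A → A) (S R : Set (ℤ → A)) (q : ℕ) (K : ℤ) :
    Measurable fun a : ℤ → A => IsParticle φ S R q K a :=
  Measurable.forall fun t => Measurable.exists fun l =>
    (measurable_isLocalized S R q K l).comp ((measurable_caMap φ).iterate t)

lemma measurable_defectLeft (S : Set (ℤ → A)) : Measurable (defectLeft S) := by
  -- The infimum of an empty or unbounded-below set of integers is 0 by convention. So nonzero
  -- values identify true minima, and the fibre over 0 is handled as a complement.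
  have key : ∀ l, l ≠ 0 → defectLeft S ⁻¹' {l} = {a | IsLeast (defectSet S a) l} := by
    intro l hl
    ext a
    refine ⟨fun h => ?_, fun h => h.csInf_eq⟩
    have h' : sInf (defectSet S a) = l := h
    by_cases hne : (defectSet S a).Nonempty ∧ BddBelow (defectSet S a)
    · exact h' ▸ ⟨Int.csInf_mem hne.1 hne.2, fun j hj => csInf_le hne.2 hj⟩
    · refine absurd ?_ hl
      rw [← h']
      rcases not_and_or.1 hne with h1 | h1
      · rw [Set.not_nonempty_iff_eq_empty.1 h1, Int.csInf_empty]
      · exact Int.csInf_of_not_bddBelow h1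
  have hm : ∀ l, l ≠ 0 → MeasurableSet (defectLeft S ⁻¹' {l}) := fun l hl => by
    rw [key l hl]
    exact measurableSet_setOfPred.2 (measurable_isLeast_defectSet S l)
  refine measurable_to_countable' fun l => ?_
  by_cases hl : l = 0
  · have : defectLeft S ⁻¹' {l} = (⋃ j : ℤ, ⋃ _ : j ≠ 0, defectLeft S ⁻¹' {j})ᶜ := by
      ext a
      simp only [hl, Set.mem_preimage, Set.mem_singleton_iff, Set.mem_compl_iff, Set.mem_iUnion]
      exact ⟨fun h ⟨j, hj, h'⟩ => hj (h'.symm.trans h), fun h => by_contra fun h0 => h ⟨_, h0, rfl⟩⟩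
    rw [this]
    exact (MeasurableSet.iUnion fun j => MeasurableSet.iUnion fun hj => hm j hj).compl
  · exact hm l hl

lemma measurable_recenter (S : Set (ℤ → A)) : Measurable (recenter S) := by
  refine measurable_pi_lambda _ fun z => ?_
  refine measurable_to_countable' fun d => ?_
  have : (fun a : ℤ → A => recenter S a z) ⁻¹' {d} =
      ⋃ l : ℤ, defectLeft S ⁻¹' {l} ∩ (fun a => a (z + l)) ⁻¹' {d} := by
    ext a; simp [recenter]
  rw [this]
  exact MeasurableSet.iUnion fun l => (measurable_defectLeft S (measurableSet_singleton l)).inter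
    (measurable_pi_apply _ (measurableSet_singleton d))

end Measurability

/-- The leftmost defect behaves like a stopping time when cells are read from left to right: its
place is decided without looking further right. This is why configurations are recentred there and
not at `defectPos`, which also involves the last defect. -/
lemma detBy_isLeast_defectSet (S : Set (ℤ → A)) (l : ℤ) :
    DetBy (l + 1) {a : ℤ → A | IsLeast (defectSet S a) l} := by
  intro a b hab ha
  refine ⟨(mem_defectSet_congr (hab l (by omega)) (hab (l + 1) le_rfl)).1 ha.1, fun j hj => ?_⟩
  by_contra hlt
  exact hlt (ha.2 ((mem_defectSet_congr (hab j (by omega)) (hab (j + 1) (by omega))).2 hj))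

/-! ### The recentred defect as a Markov chain -/

/-- The content of the window `[-M, N]`. -/
def window (M N : ℤ) (a : ℤ → A) : Finset.Icc (-M) N → A := fun z => a z

lemma detBy_window (M N : ℤ) (s : Finset.Icc (-M) N → A) : DetBy N (window M N ⁻¹' {s}) := by
  intro a b hab ha
  rw [Set.mem_preimage, Set.mem_singleton_iff] at ha ⊢
  rw [← ha]
  funext z
  exact (hab z (Finset.mem_Icc.1 z.2).2).symm

lemma measurable_window [MeasurableSpace A] (M N : ℤ) :
    Measurable (window M N : (ℤ → A) → _) :=
  measurable_pi_lambda _ fun z => measurable_pi_apply (z : ℤ)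

/-- The law of a recentred particle with content `s` in the window `[-M, N]` and uniform
transitions to the right of it. -/
structure IsStateLaw [MeasurableSpace A] (φ : A → A → A → A) (S R : Set (ℤ → A)) (q : ℕ) (K : ℤ)
    (F : ℕ) (M N : ℤ) (s : Finset.Icc (-M) N → A) (m : Measure (ℤ → A)) : Prop where
  prob : IsProbabilityMeasure m
  particle : ∀ᵐ a ∂m, IsParticle φ S R q K a ∧ defectLeft S a = 0
  window_eq : ∀ᵐ a ∂m, window M N a = s
  unif : UnifFrom R F N m

open Classical in
/-- The law of a recentred particle with content `s` in the window, or `0` if there is none. -/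
def stateLaw [MeasurableSpace A] (φ : A → A → A → A) (S R : Set (ℤ → A)) (q : ℕ) (K : ℤ) (F : ℕ)
    (M N : ℤ) (s : Finset.Icc (-M) N → A) : Measure (ℤ → A) :=
  if h : ∃ m, IsStateLaw φ S R q K F M N s m then h.choose else 0

/-- The position of a defect: an offset, depending on the width of the defect, is added to the
position of the leftmost inadmissible transition. -/
def offsetPos (S : Set (ℤ → A)) (κ : ℤ → ℤ) (a : ℤ → A) : ℤ :=
  defectLeft S a + κ (defectWidth S a)

lemma IsLocalized.offsetPos_translate {S R : Set (ℤ → A)} {q : ℕ} {K l : ℤ} {a : ℤ → A}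
    (h : IsLocalized S R q K l a) (κ : ℤ → ℤ) (k : ℤ) :
    offsetPos S κ (DefectWalk.translate k a) = offsetPos S κ a - k := by
  rw [offsetPos, offsetPos, h.defectWidth_translate, (h.translate k).defectLeft_eq,
    h.defectLeft_eq]
  ring

lemma offsetPos_congr {S : Set (ℤ → A)} {a b : ℤ → A} (h : defectSet S a = defectSet S b)
    (κ : ℤ → ℤ) : offsetPos S κ a = offsetPos S κ b := by
  simp [offsetPos, defectLeft, defectWidth, defectRight, h]

section
variable {φ : A → A → A → A} {S R : Set (ℤ → A)} {q : ℕ} {K : ℤ} {F : ℕ} {M N : ℤ}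

lemma IsParticle.isLocalized_zero {a : ℤ → A} (h : IsParticle φ S R q K a)
    (h0 : defectLeft S a = 0) : IsLocalized S R q K 0 a := by
  have := h.isLocalized 0
  rwa [Function.iterate_zero_apply, h0] at this

section Deterministic
variable [TopologicalSpace A] (hS : IsMarkovSubshift S) (hφ : Set.MapsTo (caMap φ) S S)
  (hq : 0 < q) (hM : K + q ≤ M) (p : ℕ) (hN : |K| + 2 * p + 1 ≤ N)
include hS hφ

lemma IsParticle.bounds_iterate {a : ℤ → A} (h : IsParticle φ S R q K a)
    (h0 : defectLeft S a = 0) (t : ℕ) :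
    ∀ j ∈ defectSet S ((caMap φ)^[t] a), -(t : ℤ) ≤ j ∧ j ≤ K + t := by
  have hl := h.isLocalized_zero h0
  have := bounds_defectSet_iterate hS hφ (u := 0) (v := K) (fun j hj => ⟨hl.isLeast.2 hj, by
    simpa using hl.le j hj⟩) t
  simpa using this

lemma IsParticle.neg_le_defectLeft {a : ℤ → A} (h : IsParticle φ S R q K a)
    (h0 : defectLeft S a = 0) (t : ℕ) : -(t : ℤ) ≤ defectLeft S ((caMap φ)^[t] a) :=
  (h.bounds_iterate hS hφ h0 t _ (h.isLocalized t).isLeast.1).1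

include hq hM hN

/-- The window of a recentred particle determines the positions of its defects now and `p` steps
later. -/
lemma IsParticle.defectSet_eq_of_window {a b : ℤ → A} (ha : IsParticle φ S R q K a)
    (ha0 : defectLeft S a = 0) (hb : IsParticle φ S R q K b) (hb0 : defectLeft S b = 0)
    (hab : window M N a = window M N b) {t : ℕ} (ht : t ≤ p) :
    defectSet S ((caMap φ)^[t] a) = defectSet S ((caMap φ)^[t] b) := by
  have hK := abs_le.1 (le_refl |K|)
  have h1 := (ha.isLocalized_zero ha0).eq_of_window hq hM (N := N) (by omega)
    (hb.isLocalized_zero hb0) fun z hz1 hz2 => congrFun hab ⟨z, Finset.mem_Icc.2 ⟨hz1, hz2⟩⟩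
  -- Defects at time `t` lie in cells up to `K + t`, so the cells up to `K + t + 1` matter, and
  -- these depend on initial cells up to `K + 2 * t + 1`. This is the origin of the lower bound on
  -- `N`.
  refine defectSet_congr (n := K + t) (iterate_caMap_eq_of_le φ t fun z hz => h1 z ?_)
    (fun j hj => (ha.bounds_iterate hS hφ ha0 t j hj).2)
    (fun j hj => (hb.bounds_iterate hS hφ hb0 t j hj).2)
  omega

end Deterministic

section Law
variable [Finite A] [TopologicalSpace A] [MeasurableSpace A] [MeasurableSingletonClass A]

lemma stateLaw_eq_zero_or (s : Finset.Icc (-M) N → A) :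
    stateLaw φ S R q K F M N s = 0 ∨
      IsStateLaw φ S R q K F M N s (stateLaw φ S R q K F M N s) := by
  rw [stateLaw]
  split_ifs with h
  · exact Or.inr h.choose_spec
  · exact Or.inl rfl

/-- The window fixes the left part by periodicity, and `UnifFrom.unique` fixes the law of the right
part. Hence the choice made in `stateLaw` is immaterial. -/
lemma IsStateLaw.eq_stateLaw (hF0 : F ≠ 0) (hq : 0 < q) (hM : K + q ≤ M) (hN : -K ≤ N)
    {s : Finset.Icc (-M) N → A} {m : Measure (ℤ → A)} (h : IsStateLaw φ S R q K F M N s m) :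
    m = stateLaw φ S R q K F M N s := by
  have hex : ∃ m, IsStateLaw φ S R q K F M N s m := ⟨m, h⟩
  have h' : IsStateLaw φ S R q K F M N s (stateLaw φ S R q K F M N s) := by
    rw [stateLaw, dif_pos hex]; exact hex.choose_spec
  have := h.prob
  have := h'.prob
  obtain ⟨c, hc, hc'⟩ := (h.particle.and h.window_eq).exists
  have aux : ∀ m', IsStateLaw φ S R q K F M N s m' → ∀ᵐ a ∂m', ∀ z ≤ N, a z = c z := by
    intro m' hm'
    filter_upwards [hm'.particle, hm'.window_eq] with a ha ha'
    exact (ha.1.isLocalized_zero ha.2).eq_of_window hq hM hN (hc.1.isLocalized_zero hc.2)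
      fun z hz1 hz2 => congrFun (ha'.trans hc'.symm) ⟨z, Finset.mem_Icc.2 ⟨hz1, hz2⟩⟩
  exact UnifFrom.unique hF0 h.unif h'.unif (aux _ h) (aux _ h')

/-- The window content is a past event relative to `N`, so conditioning on it preserves uniformity
and yields a state law after normalization. This supplies both fibre hypotheses of
`isMarkovMeasure_of_fibre`. -/
lemma restrict_window_eq (hF0 : F ≠ 0) (hq : 0 < q) (hM : K + q ≤ M) (hN : -K ≤ N)
    {m : Measure (ℤ → A)} [IsFiniteMeasure m]
    (hm : ∀ᵐ a ∂m, IsParticle φ S R q K a ∧ defectLeft S a = 0) (hU : UnifFrom R F N m)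
    (s : Finset.Icc (-M) N → A) :
    m.restrict (window M N ⁻¹' {s}) =
      m (window M N ⁻¹' {s}) • stateLaw φ S R q K F M N s := by
  have hmeas : MeasurableSet (window M N ⁻¹' {s} : Set (ℤ → A)) :=
    measurable_window M N (measurableSet_singleton s)
  by_cases h0 : m (window M N ⁻¹' {s}) = 0
  · rw [h0, zero_smul, Measure.restrict_eq_zero, h0]
  have hlaw : IsStateLaw φ S R q K F M N s
      ((m (window M N ⁻¹' {s}))⁻¹ • m.restrict (window M N ⁻¹' {s})) := by
    refine ⟨⟨?_⟩, ?_, ?_, (hU.restrict hmeas (detBy_window M N s)).smul _⟩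
    · rw [Measure.smul_apply, Measure.restrict_apply_univ, smul_eq_mul,
        ENNReal.inv_mul_cancel h0 (measure_ne_top _ _)]
    · exact Measure.ae_smul_measure (ae_restrict_of_ae hm) _
    · exact Measure.ae_smul_measure (ae_restrict_mem hmeas) _
  rw [← hlaw.eq_stateLaw hF0 hq hM hN, smul_smul,
    ENNReal.mul_inv_cancel h0 (measure_ne_top _ _), one_smul]

/-- For a fixed state the new leftmost defect sits at a constant place, so recentring is one fixed
translation. The `p` steps lower the threshold from `N` to `N - p`; the defect has moved left by at
most `p`, so translating raises it to at most `N`. -/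
lemma IsStateLaw.map_step (hS : IsMarkovSubshift S) (hφ : Set.MapsTo (caMap φ) S S)
    (hR : IsMarkovSubshift R) (hres : IsRightResolving φ R)
    (hF : ∀ b, Adm1 R b → (follSet R b).ncard = F) (hq : 0 < q) (hM : K + q ≤ M) (p : ℕ)
    (hN : |K| + 2 * p + 1 ≤ N) {s : Finset.Icc (-M) N → A} {m : Measure (ℤ → A)}
    (h : IsStateLaw φ S R q K F M N s m) :
    UnifFrom R F N (m.map fun a => recenter S ((caMap φ)^[p] a)) := by
  have := h.prob
  have hK := le_abs_self K
  obtain ⟨c, ⟨hc, hc0⟩, hcs⟩ := (h.particle.and h.window_eq).exists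
  have heq : (fun a => recenter S ((caMap φ)^[p] a)) =ᵐ[m]
      (translate (defectLeft S ((caMap φ)^[p] c)) ∘ (caMap φ)^[p]) := by
    filter_upwards [h.particle, h.window_eq] with a ha has
    have := ha.1.defectSet_eq_of_window hS hφ hq hM p hN ha.2 hc hc0 (has.trans hcs.symm) le_rfl
    simp [recenter, defectLeft, this]
  rw [Measure.map_congr heq,
    ← Measure.map_map (measurable_translate _) ((measurable_caMap φ).iterate p)]
  have hadm : ∀ᵐ a ∂m, ∀ z ≥ K, Adm2 R (a z) (a (z + 1)) := by
    filter_upwards [h.particle] with a ha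
    simpa using (ha.1.isLocalized_zero ha.2).adm
  refine ((h.unif.map_iterate_caMap hR hres hF p (by omega) hadm).map_translate _).mono ?_
  have := hc.neg_le_defectLeft hS hφ hc0 p
  omega

/-- Recentring at the leftmost defect preserves uniform transitions. -/
lemma UnifFrom.map_recenter {μ : Measure (ℤ → A)} {f : ℤ} (hU : UnifFrom R F f μ)
    (hpos : ∀ᵐ a ∂μ, IsLeast (defectSet S a) (defectLeft S a) ∧ |defectLeft S a| ≤ K) :
    UnifFrom R F (max f (K + 1) + K) (μ.map (recenter S)) := by
  set Y : ℤ → Set (ℤ → A) := fun j => {a | IsLeast (defectSet S a) j}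
  have hY : ∀ j, MeasurableSet (Y j) := fun j =>
    measurableSet_setOfPred.2 (measurable_isLeast_defectSet S j)
  -- Split by the position `j` of the leftmost defect; on each piece recentring is a translation.
  have hsum : μ.map (recenter S) =
      ∑ j ∈ Finset.Icc (-K) K, (μ.restrict (Y j)).map (translate j) := by
    ext E hE
    rw [Measure.finsetSum_apply, Measure.map_apply (measurable_recenter S) hE,
      measure_eq_sum_of_existsUnique (ι := Finset.Icc (-K) K) (V := fun j => Y j)
        (measurable_recenter S hE) (fun j => hY j),
      ← Finset.sum_coe_sort (Finset.Icc (-K) K) fun j => ((μ.restrict (Y j)).map (translate j)) E]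
    · refine Finset.sum_congr rfl fun j _ => ?_
      rw [Measure.map_apply (measurable_translate _) hE,
        Measure.restrict_apply (measurable_translate _ hE)]
      congr 1
      ext a
      refine and_congr_left fun hj => ?_
      have hj' : defectLeft S a = j := IsLeast.csInf_eq hj
      simp [recenter, hj']
    · filter_upwards [hpos] with a ha _
      exact ⟨⟨_, Finset.mem_Icc.2 (abs_le.1 ha.2)⟩, ha.1,
        fun j hj => Subtype.ext (hj.unique ha.1)⟩
  rw [hsum]
  refine UnifFrom.finsetSum fun j hj => ?_
  have hj' := Finset.mem_Icc.1 hj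
  -- From `K + 1` on, the position `j ≤ K` is a past event; the translation by `j ≥ -K` raises the
  -- threshold by at most `K`.
  refine (((hU.mono (le_max_left f (K + 1))).restrict (hY j)
    ((detBy_isLeast_defectSet S j).mono ?_)).map_translate j).mono ?_ <;> omega

end Law

/-- If the sequence to the right of a particle has uniform transitions, then the sampled positions
of the particle form a random walk. -/
theorem isRandomWalk_of_unifFrom [Fintype A] [TopologicalSpace A] [MeasurableSpace A]
    [MeasurableSingletonClass A] (hS : IsMarkovSubshift S) (hφ : Set.MapsTo (caMap φ) S S)
    (hR : IsMarkovSubshift R) (hres : IsRightResolving φ R)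
    (hF : ∀ b, Adm1 R b → (follSet R b).ncard = F) (hF0 : F ≠ 0) (hq : 0 < q) (p : ℕ)
    (κ : ℤ → ℤ) {μ : Measure (ℤ → A)} [IsProbabilityMeasure μ] {f : ℤ} (hU : UnifFrom R F f μ)
    (hpart : ∀ᵐ a ∂μ, IsParticle φ S R q K a)
    (hpos : ∀ᵐ a ∂μ, |defectLeft S a| ≤ K ∧ offsetPos S κ a = 0) :
    AEMeasurable (fun a k => offsetPos S κ ((caMap φ)^[p * k] a)) μ ∧
      IsRandomWalk (μ.map fun a k => offsetPos S κ ((caMap φ)^[p * k] a)) := by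
  classical
  set M : ℤ := K + q with hMdef
  -- The first bound makes the recentred initial law uniform beyond `N`; the second lets the window
  -- determine the motion during `p` steps.
  set N : ℤ := max (max f (K + 1) + K) (|K| + 2 * p + 1) with hNdef
  have hM : K + q ≤ M := le_rfl
  have hN : |K| + 2 * p + 1 ≤ N := le_max_right _ _
  have hN' : -K ≤ N := by
    have := neg_abs_le K
    omega
  set T : (ℤ → A) → (ℤ → A) := fun a => recenter S ((caMap φ)^[p] a) with hT
  have hTm : Measurable T := (measurable_recenter S).comp ((measurable_caMap φ).iterate p)
  set P := stateLaw φ S R q K F M N with hPdef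
  set μ' := μ.map (recenter S) with hμ'
  have : IsProbabilityMeasure μ' :=
    Measure.isProbabilityMeasure_map (measurable_recenter S).aemeasurable
  have hpartm : MeasurableSet {a : ℤ → A | IsParticle φ S R q K a ∧ defectLeft S a = 0} :=
    (measurableSet_setOfPred.2 (measurable_isParticle φ S R q K)).inter
      (measurable_defectLeft S (measurableSet_singleton 0))
  have hmarkov : IsMarkovMeasure (μ'.map fun a n => window M N (T^[n] a)) := by
    refine isMarkovMeasure_of_fibre (window M N) T (measurable_window M N) hTm P
      (fun s => (stateLaw_eq_zero_or s).imp_right fun h => h.prob) (fun s s' => ?_) μ'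
      fun s => ?_
    · rcases stateLaw_eq_zero_or (φ := φ) (S := S) (R := R) (q := q) (K := K) (F := F) s with h | h
      · have h' : P s = 0 := h
        simp [h']
      · have := h.prob
        refine restrict_window_eq hF0 hq hM hN' ?_ (h.map_step hS hφ hR hres hF hq hM p hN) s'
        rw [ae_map_iff hTm.aemeasurable hpartm]
        filter_upwards [h.particle] with a ha
        exact (ha.1.iterate p).recenter
    · refine restrict_window_eq hF0 hq hM hN' ?_
        ((hU.map_recenter (K := K) (S := S) ?_).mono (le_max_left _ _)) s
      · rw [ae_map_iff (measurable_recenter S).aemeasurable hpartm]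
        filter_upwards [hpart] with a ha using ha.recenter
      · filter_upwards [hpart, hpos] with a ha ha'
        exact ⟨(ha.isLocalized 0).isLeast, ha'.1⟩
  -- The increment is read off from any recentred particle with this window; by
  -- `IsParticle.defectSet_eq_of_window` the choice does not matter. Contents carried by no particle
  -- get the value 0.
  set ψ : (Finset.Icc (-M) N → A) → ℤ := fun s =>
    if h : ∃ b, (IsParticle φ S R q K b ∧ defectLeft S b = 0) ∧ window M N b = s
    then offsetPos S κ ((caMap φ)^[p] h.choose) - offsetPos S κ h.choose else 0 with hψdef
  have hψ : ∀ b, IsParticle φ S R q K b → ψ (window M N (recenter S b)) =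
      offsetPos S κ ((caMap φ)^[p] b) - offsetPos S κ b := by
    intro b hb
    have hex : ∃ c, (IsParticle φ S R q K c ∧ defectLeft S c = 0) ∧
        window M N c = window M N (recenter S b) := ⟨_, hb.recenter, rfl⟩
    have hc := hex.choose_spec
    have h1 : ∀ t ≤ p, offsetPos S κ ((caMap φ)^[t] hex.choose) =
        offsetPos S κ ((caMap φ)^[t] b) - defectLeft S b := by
      intro t ht
      rw [offsetPos_congr (hc.1.1.defectSet_eq_of_window hS hφ hq hM p hN hc.1.2 hb.recenter.1
        hb.recenter.2 hc.2 ht), recenter, iterate_caMap_translate,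
        (hb.isLocalized t).offsetPos_translate]
    have h2 := h1 p le_rfl
    have h3 := h1 0 (Nat.zero_le _)
    simp only [Function.iterate_zero_apply] at h3
    simp only [hψdef, dif_pos hex, h2, h3]
    ring
  set e : (Finset.Icc (-M) N → A) ≃ᵐ Fin (Fintype.card (Finset.Icc (-M) N → A)) :=
    ⟨Fintype.equivFin _, Measurable.of_discrete, Measurable.of_discrete⟩
  have m1 : Measurable fun (a : ℤ → A) n => window M N (T^[n] a) :=
    measurable_pi_lambda _ fun n => (measurable_window M N).comp (hTm.iterate n)
  have m2 : Measurable fun (x : ℕ → Finset.Icc (-M) N → A) n => e (x n) :=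
    measurable_pi_lambda _ fun n => e.measurable.comp (measurable_pi_apply n)
  have m3 : Measurable fun (x : ℕ → Fin (Fintype.card (Finset.Icc (-M) N → A))) n =>
      ψ (e.symm (x n)) :=
    measurable_pi_lambda _ fun n => (Measurable.of_discrete (f := fun i => ψ (e.symm i))).comp
      (measurable_pi_apply n)
  have m4 : Measurable partialSums := measurable_pi_lambda _ fun n =>
    Finset.measurable_fun_sum _ fun i _ => measurable_pi_apply i
  have m5 := (m4.comp (m3.comp (m2.comp m1))).comp (measurable_recenter S)
  -- The increments telescope, and the initial position is 0 by `hpos`.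
  have hae : (fun a k => offsetPos S κ ((caMap φ)^[p * k] a)) =ᵐ[μ]
      (partialSums ∘ (fun x n => ψ (e.symm (x n))) ∘ (fun x n => e (x n)) ∘
        fun a n => window M N (T^[n] a)) ∘ recenter S := by
    filter_upwards [hpart, hpos] with a ha ha'
    have hiter : ∀ n, T^[n] (recenter S a) = recenter S ((caMap φ)^[p * n] a) := by
      intro n
      induction n with
      | zero => simp
      | succ n ih =>
        rw [Function.iterate_succ_apply', ih, hT]
        simp only
        rw [(ha.iterate (p * n)).recenter_iterate_recenter, ← Function.iterate_add_apply,
          Nat.mul_succ, add_comm]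
    funext n
    simp only [Function.comp_apply, partialSums, MeasurableEquiv.symm_apply_apply, hiter]
    induction n with
    | zero => simpa using ha'.2
    | succ n ih =>
      rw [Finset.sum_range_succ, ← ih, hψ _ (ha.iterate (p * n)), ← Function.iterate_add_apply,
        Nat.mul_succ, add_comm p]
      ring
  refine ⟨⟨_, m5, hae⟩, _, ⟨_, _, fun i => ψ (e.symm i), hmarkov.map_equiv e, rfl⟩, ?_⟩
  rw [Measure.map_map m2 m1, Measure.map_map m3 (m2.comp m1),
    Measure.map_map m4 (m3.comp (m2.comp m1)), hμ',
    Measure.map_map (m4.comp (m3.comp (m2.comp m1))) (measurable_recenter S)]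
  exact Measure.map_congr hae

end

/-! ### Entropy inequalities for finite distributions -/

/-- This is `log t ≤ t - 1` at `t = y / x`, multiplied by `x`. Summed over a distribution it becomes
Gibbs' inequality; the strict version settles the equality case. -/
lemma negMulLog_le_of_pos {x y : ℝ} (hx : 0 ≤ x) (hy : 0 < y) :
    Real.negMulLog x ≤ -x * Real.log y + y - x := by
  rcases hx.eq_or_lt with rfl | hx
  · simp [hy.le]
  have h := Real.log_le_sub_one_of_pos (div_pos hy hx)
  rw [Real.log_div hy.ne' hx.ne'] at h
  have h2 := mul_le_mul_of_nonneg_left h hx.le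
  have h3 : x * (y / x - 1) = y - x := by field_simp
  rw [h3] at h2
  rw [Real.negMulLog]
  linarith

lemma negMulLog_lt_of_pos_of_ne {x y : ℝ} (hx : 0 ≤ x) (hy : 0 < y) (hxy : x ≠ y) :
    Real.negMulLog x < -x * Real.log y + y - x := by
  rcases hx.eq_or_lt with rfl | hx
  · simp [hy]
  have h := Real.log_lt_sub_one_of_pos (div_pos hy hx) (by
    rw [Ne, div_eq_one_iff_eq hx.ne']; exact hxy.symm)
  rw [Real.log_div hy.ne' hx.ne'] at h
  have h2 := mul_lt_mul_of_pos_left h hx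
  have h3 : x * (y / x - 1) = y - x := by field_simp
  rw [h3] at h2
  rw [Real.negMulLog]
  linarith

/-- Strong subadditivity of the Shannon entropy. -/
lemma sum_negMulLog_add_le {X Y Z : Type*} [Fintype X] [Fintype Y] [Fintype Z]
    (p : X → Y → Z → ℝ) (hp : ∀ x y z, 0 ≤ p x y z) :
    ∑ x, ∑ y, ∑ z, Real.negMulLog (p x y z) + ∑ y, Real.negMulLog (∑ x, ∑ z, p x y z) ≤
      ∑ x, ∑ y, Real.negMulLog (∑ z, p x y z) + ∑ y, ∑ z, Real.negMulLog (∑ x, p x y z) := by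
  set pxy : X → Y → ℝ := fun x y => ∑ z, p x y z with hxy
  set pyz : Y → Z → ℝ := fun y z => ∑ x, p x y z with hyz
  set py : Y → ℝ := fun y => ∑ x, ∑ z, p x y z with hy
  have hxy0 : ∀ x y, 0 ≤ pxy x y := fun x y => Finset.sum_nonneg fun z _ => hp x y z
  have hyz0 : ∀ y z, 0 ≤ pyz y z := fun y z => Finset.sum_nonneg fun x _ => hp x y z
  have hpy : ∀ y, py y = ∑ z, pyz y z := fun y => Finset.sum_comm
  have hle1 : ∀ x y z, p x y z ≤ pxy x y := fun x y z =>
    Finset.single_le_sum (f := fun z => p x y z) (fun z _ => hp x y z) (Finset.mem_univ z)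
  have hle2 : ∀ x y z, p x y z ≤ pyz y z := fun x y z =>
    Finset.single_le_sum (f := fun x => p x y z) (fun x _ => hp x y z) (Finset.mem_univ x)
  have hle3 : ∀ x y, pxy x y ≤ py y := fun x y =>
    Finset.single_le_sum (f := fun x => pxy x y) (fun x _ => hxy0 x y) (Finset.mem_univ x)
  -- Gibbs' inequality against the reference weights `pxy * pyz / py`, under which the outer
  -- variables are conditionally independent given the middle one. These have the same total mass as
  -- `p`, so the linear terms cancel after summation.
  have key : ∀ x y z, Real.negMulLog (p x y z) ≤ -(p x y z * Real.log (pxy x y)) -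
      p x y z * Real.log (pyz y z) + p x y z * Real.log (py y) +
      pxy x y * pyz y z / py y - p x y z := by
    intro x y z
    rcases (hp x y z).eq_or_lt with h | h
    · rw [← h]
      have := div_nonneg (mul_nonneg (hxy0 x y) (hyz0 y z)) ((hxy0 x y).trans (hle3 x y))
      simpa using this
    · have h1 := h.trans_le (hle1 x y z)
      have h2 := h.trans_le (hle2 x y z)
      have h3 := h1.trans_le (hle3 x y)
      have := negMulLog_le_of_pos h.le (div_pos (mul_pos h1 h2) h3)
      rw [Real.log_div (mul_pos h1 h2).ne' h3.ne', Real.log_mul h1.ne' h2.ne'] at this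
      linarith
  have hsum := Finset.sum_le_sum fun x (_ : x ∈ Finset.univ) => Finset.sum_le_sum
    fun y (_ : y ∈ Finset.univ) => Finset.sum_le_sum fun z (_ : z ∈ Finset.univ) => key x y z
  simp only [Finset.sum_add_distrib, Finset.sum_sub_distrib, Finset.sum_neg_distrib] at hsum
  have e1 : ∑ x, ∑ y, ∑ z, p x y z * Real.log (pxy x y) =
      -∑ x, ∑ y, Real.negMulLog (pxy x y) := by
    simp only [← Finset.sum_mul, Real.negMulLog, neg_mul, Finset.sum_neg_distrib, neg_neg, hxy]
  have e2 : ∑ x, ∑ y, ∑ z, p x y z * Real.log (pyz y z) =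
      -∑ y, ∑ z, Real.negMulLog (pyz y z) := by
    rw [Finset.sum_comm]
    simp only [Real.negMulLog, neg_mul, Finset.sum_neg_distrib, neg_neg]
    refine Finset.sum_congr rfl fun y _ => ?_
    rw [Finset.sum_comm]
    simp only [← Finset.sum_mul, hyz]
  have e3 : ∑ x, ∑ y, ∑ z, p x y z * Real.log (py y) = -∑ y, Real.negMulLog (py y) := by
    rw [Finset.sum_comm]
    simp only [← Finset.sum_mul, Real.negMulLog, neg_mul, Finset.sum_neg_distrib, neg_neg, hy]
  have e4 : ∑ x, ∑ y, ∑ z, pxy x y * pyz y z / py y = ∑ x, ∑ y, ∑ z, p x y z := by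
    rw [Finset.sum_comm, Finset.sum_comm (f := fun x y => ∑ z, p x y z)]
    refine Finset.sum_congr rfl fun y _ => ?_
    have : ∀ x, ∑ z, pxy x y * pyz y z / py y = pxy x y * py y / py y := fun x => by
      rw [hpy, ← Finset.sum_div, ← Finset.mul_sum]
    simp only [this, ← Finset.sum_div, ← Finset.sum_mul]
    change py y * py y / py y = py y
    rw [mul_self_div_self]
  rw [e1, e2, e3, e4] at hsum
  linarith

/-- A distribution of mass `P` on at most `F` points has entropy at most `-P log (P / F)`. -/
lemma sum_negMulLog_le_card {D : Type*} [Fintype D] {p : D → ℝ} (hp : ∀ d, 0 ≤ p d)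
    {s : Finset D} {F : ℕ} (hF : F ≠ 0) (hs : ∑ d, p d ≠ 0 → s.card = F)
    (hps : ∀ d ∉ s, p d = 0) :
    ∑ d, Real.negMulLog (p d) ≤ Real.negMulLog (∑ d, p d) + (∑ d, p d) * Real.log F ∧
      (∑ d, Real.negMulLog (p d) = Real.negMulLog (∑ d, p d) + (∑ d, p d) * Real.log F ↔
        ∀ d ∈ s, p d * F = ∑ d, p d) := by
  set P := ∑ d, p d with hP
  rcases (Finset.sum_nonneg fun d (_ : d ∈ Finset.univ) => hp d).eq_or_lt with h0 | h0
  · have h1 : ∀ d, p d = 0 := fun d =>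
      (Finset.sum_eq_zero_iff_of_nonneg fun d _ => hp d).1 h0.symm d (Finset.mem_univ d)
    have h2 : P = 0 := h0.symm
    simp [h1, h2]
  have hFpos : (0 : ℝ) < F := by positivity
  -- The reference distribution gives each of the `F` points the mass `P / F`; termwise equality in
  -- Gibbs' inequality characterizes equality of the sums.
  have hy : 0 < P / F := div_pos h0 hFpos
  have hcard := hs h0.ne'
  have hsumP : ∑ d ∈ s, p d = P := Finset.sum_subset (Finset.subset_univ s) fun d _ hd => hps d hd
  have hsumN : ∑ d ∈ s, Real.negMulLog (p d) = ∑ d, Real.negMulLog (p d) :=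
    Finset.sum_subset (Finset.subset_univ s) fun d _ hd => by simp [hps d hd]
  have hR : ∑ d ∈ s, (-p d * Real.log (P / F) + P / F - p d) =
      Real.negMulLog P + P * Real.log F := by
    rw [Finset.sum_sub_distrib, Finset.sum_add_distrib, ← Finset.sum_mul, Finset.sum_neg_distrib,
      hsumP, Finset.sum_const, hcard, nsmul_eq_mul, mul_div_cancel₀ _ hFpos.ne',
      Real.log_div h0.ne' hFpos.ne', Real.negMulLog]
    ring
  rw [← hsumN, ← hR]
  refine ⟨Finset.sum_le_sum fun d _ => negMulLog_le_of_pos (hp d) hy, ?_⟩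
  rw [Finset.sum_eq_sum_iff_of_le fun d _ => negMulLog_le_of_pos (hp d) hy]
  refine forall₂_congr fun d _ => ⟨fun h => ?_, fun h => ?_⟩
  · by_contra hne
    refine (negMulLog_lt_of_pos_of_ne (hp d) hy fun h' => hne ?_).ne h
    rw [h', div_mul_cancel₀ _ hFpos.ne']
  · have : p d = P / F := by rw [← h, mul_div_cancel_right₀ _ hFpos.ne']
    rw [this, Real.negMulLog]; ring

/-! ### Entropy of random variables -/

section entropyOf
variable {Ω V V' X Y Z : Type*} [MeasurableSpace Ω] [Fintype V] [Fintype V'] [Fintype X]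
  [Fintype Y] [Fintype Z] [MeasurableSpace V]
  [MeasurableSpace X] [MeasurableSpace Y] [MeasurableSpace Z] [MeasurableSingletonClass V]
  [MeasurableSingletonClass X] [MeasurableSingletonClass Y] [MeasurableSingletonClass Z]

/-- The Shannon entropy of a random variable with finitely many values. -/
def entropyOf (η : Measure Ω) (f : Ω → V) : ℝ := ∑ v, Real.negMulLog (η.real (f ⁻¹' {v}))

lemma entropyOf_comp_injective (η : Measure Ω) (f : Ω → V) {e : V → V'}
    (he : Function.Injective e) : entropyOf η (fun ω => e (f ω)) = entropyOf η f := by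
  classical
  rw [entropyOf, entropyOf,
    ← Finset.sum_subset (Finset.subset_univ (Finset.univ.image e)), Finset.sum_image he.injOn]
  · refine Finset.sum_congr rfl fun v _ => ?_
    congr 2
    ext ω
    simp [he.eq_iff]
  · intro v' _ hv'
    have : (fun ω => e (f ω)) ⁻¹' {v'} = ∅ := by
      refine Set.eq_empty_of_forall_notMem fun ω hω => hv' ?_
      exact Finset.mem_image.2 ⟨f ω, Finset.mem_univ _, hω⟩
    simp [this]

lemma entropyOf_comp_invariant {η : Measure Ω} {T : Ω → Ω} (hT : Measurable T)
    (hη : η.map T = η) {f : Ω → V} (hf : Measurable f) :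
    entropyOf η (fun ω => f (T ω)) = entropyOf η f := by
  refine Finset.sum_congr rfl fun v _ => ?_
  have h1 := map_measureReal_apply (μ := η) hT (hf (measurableSet_singleton v))
  rw [hη] at h1
  rw [h1]
  rfl

lemma measureReal_eq_sum_inter {η : Measure Ω} [IsFiniteMeasure η] {E : Set Ω}
    (hE : MeasurableSet E) {f : Ω → V} (hf : Measurable f) :
    η.real E = ∑ v, η.real (E ∩ f ⁻¹' {v}) := by
  rw [measureReal_def, measure_eq_sum_of_existsUnique hE
    (fun v => hf (measurableSet_singleton v))
    (Eventually.of_forall fun ω _ => ⟨f ω, rfl, fun _ h => h.symm⟩),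
    ENNReal.toReal_sum fun v _ => measure_ne_top _ _]
  rfl

lemma entropyOf_triple_add_le {η : Measure Ω} [IsFiniteMeasure η] {f : Ω → X} {g : Ω → Y}
    {h : Ω → Z} (hf : Measurable f) (hg : Measurable g) (hh : Measurable h) :
    entropyOf η (fun ω => (f ω, g ω, h ω)) + entropyOf η g ≤
      entropyOf η (fun ω => (f ω, g ω)) + entropyOf η (fun ω => (g ω, h ω)) := by
  have hfm : ∀ x, MeasurableSet (f ⁻¹' {x}) := fun x => hf (measurableSet_singleton x)
  have hgm : ∀ x, MeasurableSet (g ⁻¹' {x}) := fun x => hg (measurableSet_singleton x)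
  have hhm : ∀ x, MeasurableSet (h ⁻¹' {x}) := fun x => hh (measurableSet_singleton x)
  set p : X → Y → Z → ℝ := fun x y z => η.real (f ⁻¹' {x} ∩ g ⁻¹' {y} ∩ h ⁻¹' {z}) with hp
  have e0 : ∀ x y z, (fun ω => (f ω, g ω, h ω)) ⁻¹' {(x, y, z)} =
      f ⁻¹' {x} ∩ g ⁻¹' {y} ∩ h ⁻¹' {z} := by
    intro x y z; ext ω; simp [and_assoc]
  have e1 : ∀ x y, (fun ω => (f ω, g ω)) ⁻¹' {(x, y)} = f ⁻¹' {x} ∩ g ⁻¹' {y} := by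
    intro x y; ext ω; simp
  have e2 : ∀ y z, (fun ω => (g ω, h ω)) ⁻¹' {(y, z)} = g ⁻¹' {y} ∩ h ⁻¹' {z} := by
    intro y z; ext ω; simp
  have s1 : ∀ x y, η.real (f ⁻¹' {x} ∩ g ⁻¹' {y}) = ∑ z, p x y z := fun x y =>
    measureReal_eq_sum_inter ((hfm x).inter (hgm y)) hh
  have s2 : ∀ y z, η.real (g ⁻¹' {y} ∩ h ⁻¹' {z}) = ∑ x, p x y z := fun y z => by
    rw [measureReal_eq_sum_inter ((hgm y).inter (hhm z)) hf]
    refine Finset.sum_congr rfl fun x _ => ?_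
    rw [Set.inter_comm, ← Set.inter_assoc]
  have s3 : ∀ y, η.real (g ⁻¹' {y}) = ∑ x, ∑ z, p x y z := fun y => by
    rw [measureReal_eq_sum_inter (hgm y) hf]
    refine Finset.sum_congr rfl fun x _ => ?_
    rw [Set.inter_comm, s1]
  have := sum_negMulLog_add_le p fun x y z => measureReal_nonneg
  simpa only [entropyOf, Fintype.sum_prod_type, e0, e1, e2, s1, s2, s3] using this

/-- The entropy gained by observing a further letter with at most `F` possible values. -/
lemma entropyOf_pair_le {η : Measure Ω} [IsProbabilityMeasure η] {f : Ω → X} {g : Ω → Y}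
    (hf : Measurable f) (hg : Measurable g) {s : X → Finset Y} {F : ℕ} (hF : F ≠ 0)
    (hs : ∀ x, η.real (f ⁻¹' {x}) ≠ 0 → (s x).card = F) (hgs : ∀ᵐ ω ∂η, g ω ∈ s (f ω)) :
    entropyOf η (fun ω => (f ω, g ω)) ≤ entropyOf η f + Real.log F ∧
      (entropyOf η (fun ω => (f ω, g ω)) = entropyOf η f + Real.log F ↔
        ∀ x, ∀ y ∈ s x, η.real (f ⁻¹' {x} ∩ g ⁻¹' {y}) * F = η.real (f ⁻¹' {x})) := by
  have hfm : ∀ x, MeasurableSet (f ⁻¹' {x}) := fun x => hf (measurableSet_singleton x)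
  have e1 : ∀ x y, (fun ω => (f ω, g ω)) ⁻¹' {(x, y)} = f ⁻¹' {x} ∩ g ⁻¹' {y} := by
    intro x y; ext ω; simp
  have s1 : ∀ x, η.real (f ⁻¹' {x}) = ∑ y, η.real (f ⁻¹' {x} ∩ g ⁻¹' {y}) := fun x =>
    measureReal_eq_sum_inter (hfm x) hg
  have hsum : ∑ x, η.real (f ⁻¹' {x}) = 1 := by
    have := measureReal_eq_sum_inter (η := η) MeasurableSet.univ hf
    simp only [Set.univ_inter, probReal_univ] at this
    exact this.symm
  have hzero : ∀ x, ∀ y ∉ s x, η.real (f ⁻¹' {x} ∩ g ⁻¹' {y}) = 0 := by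
    intro x y hy
    rw [measureReal_eq_zero_iff]
    refine measure_eq_zero_iff_ae_notMem.2 ?_
    filter_upwards [hgs] with ω hω hmem
    have h1 : f ω = x := hmem.1
    have h2 : g ω = y := hmem.2
    exact hy (h1 ▸ h2 ▸ hω)
  have key := fun x => sum_negMulLog_le_card (p := fun y => η.real (f ⁻¹' {x} ∩ g ⁻¹' {y}))
    (fun y => measureReal_nonneg) (s := s x) hF (by rw [← s1]; exact hs x) (hzero x)
  simp only [← s1] at key
  have hR : entropyOf η f + Real.log F = ∑ x, (Real.negMulLog (η.real (f ⁻¹' {x})) +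
      η.real (f ⁻¹' {x}) * Real.log F) := by
    rw [Finset.sum_add_distrib, ← Finset.sum_mul, hsum, one_mul, entropyOf]
  have hL : entropyOf η (fun ω => (f ω, g ω)) =
      ∑ x, ∑ y, Real.negMulLog (η.real (f ⁻¹' {x} ∩ g ⁻¹' {y})) := by
    simp only [entropyOf, Fintype.sum_prod_type, e1]
  rw [hR, hL]
  refine ⟨Finset.sum_le_sum fun x _ => (key x).1, ?_⟩
  rw [Finset.sum_eq_sum_iff_of_le fun x _ => (key x).1]
  simp only [Finset.mem_univ, true_implies]
  exact forall_congr' fun x => (key x).2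

end entropyOf

/-! ### Block entropies of invariant measures -/

section Block
variable [Fintype A] [MeasurableSpace A] [MeasurableSingletonClass A]

/-- The block in the coordinates `0, …, n - 1`. -/
def block (n : ℕ) (a : ℤ → A) : Fin n → A := fun i => a ((i : ℕ) : ℤ)

lemma measurable_block (n : ℕ) : Measurable (block n : (ℤ → A) → _) :=
  measurable_pi_lambda _ fun _ => measurable_pi_apply _

lemma preimage_block (n : ℕ) (w : Fin n → A) :
    block n ⁻¹' {w} = {a : ℤ → A | ∀ i : Fin n, a ((i : ℕ) : ℤ) = w i} := by
  ext a
  simp [block, funext_iff]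

lemma blockEntropy_eq (η : Measure (ℤ → A)) (n : ℕ) :
    blockEntropy η n = entropyOf η (block n) := by
  simp only [blockEntropy, entropyOf, preimage_block]

lemma map_translate_nat {η : Measure (ℤ → A)} (hη : η.map shift = η) (k : ℕ) :
    η.map (translate (k : ℤ)) = η := by
  induction k with
  | zero =>
    have : (translate (0 : ℤ) : (ℤ → A) → _) = id := funext translate_zero
    simp [this]
  | succ k ih =>
    have : (translate ((k + 1 : ℕ) : ℤ) : (ℤ → A) → _) = translate (k : ℤ) ∘ shift := by
      funext a
      simp [shift_eq_translate, translate_translate]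
    rw [this, ← Measure.map_map (measurable_translate _) measurable_shift, hη, ih]

lemma map_translate_int {η : Measure (ℤ → A)} (hη : η.map shift = η) (k : ℤ) :
    η.map (translate k) = η := by
  obtain ⟨n, rfl | rfl⟩ := k.eq_nat_or_neg
  · exact map_translate_nat hη n
  · conv_lhs => rw [← map_translate_nat hη n]
    rw [Measure.map_map (measurable_translate _) (measurable_translate _)]
    have : (translate (-(n : ℤ)) ∘ translate (n : ℤ) : (ℤ → A) → _) = id := by
      funext a; simp [translate_translate]
    rw [this, Measure.map_id]

/-- Strong subadditivity for two blocks that overlap in the single letter at `m`. Subtracting the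
one-letter entropy gives a subadditive sequence whose upper bound is exactly `n * log F`, with no
boundary term. -/
lemma blockEntropy_add_le {η : Measure (ℤ → A)} [IsFiniteMeasure η] (hη : η.map shift = η)
    (m n : ℕ) : blockEntropy η (m + n + 1) + blockEntropy η 1 ≤
      blockEntropy η (m + 1) + blockEntropy η (n + 1) := by
  simp only [blockEntropy_eq]
  have hmeas : Measurable fun a : ℤ → A => a m := measurable_pi_apply _
  have hmeas' : Measurable fun (a : ℤ → A) (i : Fin n) => a (m + 1 + (i : ℕ)) :=
    measurable_pi_lambda _ fun _ => measurable_pi_apply _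
  have key := entropyOf_triple_add_le (η := η) (measurable_block m) hmeas hmeas'
  have e1 : entropyOf η (fun a : ℤ → A => (block m a, a m, fun i : Fin n => a (m + 1 + (i : ℕ)))) =
      entropyOf η (block (m + n + 1)) := by
    rw [← entropyOf_comp_injective η (block (m + n + 1))
      (e := fun w => (fun i : Fin m => w ⟨i, by omega⟩, w ⟨m, by omega⟩,
        fun i : Fin n => w ⟨m + 1 + i, by omega⟩))]
    · simp [block]; rfl
    · intro w w' h
      simp only [Prod.mk.injEq, funext_iff] at h
      funext ⟨i, hi⟩
      rcases lt_trichotomy i m with h1 | h1 | h1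
      · exact h.1 ⟨i, h1⟩
      · subst h1; exact h.2.1
      · have := h.2.2 ⟨i - (m + 1), by omega⟩
        simpa [show m + 1 + (i - (m + 1)) = i by omega] using this
  have e2 : entropyOf η (fun a : ℤ → A => a m) = entropyOf η (block 1) := by
    have h1 := entropyOf_comp_invariant (measurable_translate (m : ℤ)) (map_translate_nat hη m)
      (measurable_block (A := A) 1)
    rw [← h1, ← entropyOf_comp_injective η (fun a : ℤ → A => a m) (e := fun x (_ : Fin 1) => x)]
    · congr 1; funext a i
      simp [block]
    · intro x y h; exact congrFun h 0
  have e3 : entropyOf η (fun a : ℤ → A => (block m a, a m)) = entropyOf η (block (m + 1)) := by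
    rw [← entropyOf_comp_injective η (block (m + 1))
      (e := fun w => (fun i : Fin m => w ⟨i, by omega⟩, w ⟨m, by omega⟩))]
    · simp [block]; rfl
    · intro w w' h
      simp only [Prod.mk.injEq, funext_iff] at h
      funext ⟨i, hi⟩
      rcases Nat.lt_succ_iff_lt_or_eq.1 hi with h1 | h1
      · exact h.1 ⟨i, h1⟩
      · subst h1; exact h.2
  have e4 : entropyOf η (fun a : ℤ → A => (a m, fun i : Fin n => a (m + 1 + (i : ℕ)))) =
      entropyOf η (block (n + 1)) := by
    have h1 := entropyOf_comp_invariant (measurable_translate (m : ℤ)) (map_translate_nat hη m)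
      (measurable_block (A := A) (n + 1))
    rw [← h1, ← entropyOf_comp_injective η (fun a : ℤ → A => block (n + 1) (translate (m : ℤ) a))
      (e := fun w => (w 0, fun i : Fin n => w i.succ))]
    · congr 1; funext a
      simp only [block, translate_apply, Fin.val_zero, Fin.val_succ, Nat.cast_zero, zero_add,
        Nat.cast_add, Nat.cast_one, Prod.mk.injEq, true_and]
      funext i
      congr 1; ring
    · intro w w' h
      simp only [Prod.mk.injEq, funext_iff] at h
      funext i
      exact Fin.cases h.1 h.2 i
  rw [e1, e2, e3, e4] at key
  exact key

variable {R : Set (ℤ → A)} {F : ℕ}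

/-- Given the block, the next letter has only `F` possible values. Equality holds exactly when it is
uniform among them, which is the property sought for Parry measures. -/
lemma blockEntropy_succ_le (hF : ∀ b, Adm1 R b → (follSet R b).ncard = F)
    (hF0 : F ≠ 0) {η : Measure (ℤ → A)} [IsProbabilityMeasure η]
    (hη : ∀ z : ℤ, ∀ᵐ a ∂η, Adm2 R (a z) (a (z + 1))) (n : ℕ) :
    blockEntropy η (n + 2) ≤ blockEntropy η (n + 1) + Real.log F ∧
      (blockEntropy η (n + 2) = blockEntropy η (n + 1) + Real.log F ↔
        ∀ x : ℤ → A, Adm2 R (x n) (x (n + 1)) →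
          η (box 0 (n + 1) x) * F = η (box 0 n x)) := by
  classical
  simp only [blockEntropy_eq]
  have hmeas : Measurable fun a : ℤ → A => a (n + 1) := measurable_pi_apply _
  set s : (Fin (n + 1) → A) → Finset A := fun w => (Set.toFinite (follSet R (w (Fin.last n)))).toFinset
    with hs
  have key := entropyOf_pair_le (η := η) (measurable_block (n + 1)) hmeas (s := s) hF0 ?_ ?_
  · have e1 : entropyOf η (fun a : ℤ → A => (block (n + 1) a, a (n + 1))) =
        entropyOf η (block (n + 2)) := by
      rw [← entropyOf_comp_injective η (block (n + 2))
        (e := fun w => (fun i : Fin (n + 1) => w i.castSucc, w (Fin.last (n + 1))))]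
      · rfl
      · intro w w' h
        simp only [Prod.mk.injEq, funext_iff] at h
        funext i
        exact Fin.lastCases h.2 h.1 i
    have hbox : ∀ x : ℤ → A, block (n + 1) ⁻¹' {block (n + 1) x} = box 0 n x := by
      intro x
      ext a
      simp only [Set.mem_preimage, Set.mem_singleton_iff, funext_iff, block, box,
        Set.mem_ofPred_eq]
      refine ⟨fun h z h1 h2 => ?_, fun h i => h _ (by omega) (by omega)⟩
      have := h ⟨z.toNat, by omega⟩
      simpa [h1] using this
    rw [e1] at key
    refine ⟨key.1, key.2.trans ⟨fun h x hx => ?_, fun h w y hy => ?_⟩⟩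
    · have h1 := h (block (n + 1) x) (x (n + 1)) (by
        rw [hs, Set.Finite.mem_toFinset]; simpa [block, follSet] using hx)
      rw [hbox] at h1
      rw [box_succ (by omega)]
      rw [measureReal_def, measureReal_def, ← ENNReal.toReal_natCast, ← ENNReal.toReal_mul] at h1
      exact (ENNReal.toReal_eq_toReal_iff' (ENNReal.mul_ne_top (measure_ne_top _ _)
        (ENNReal.natCast_ne_top _)) (measure_ne_top _ _)).1 h1
    -- Any extension of the word `w` followed by `y` will do; negative cells are irrelevant because
    -- the boxes start at 0.
    · set x : ℤ → A := fun z => if h : z.toNat < n + 1 then w ⟨z.toNat, h⟩ else y with hxdef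
      have hxw : block (n + 1) x = w := by
        funext i
        have : ((i : ℕ) : ℤ).toNat < n + 1 := i.2
        simp only [block, hxdef, dif_pos this]
        rfl
      have hxy : x (n + 1) = y := by
        have : ¬ ((n : ℤ) + 1).toNat < n + 1 := by omega
        simp [hxdef]
      have hxn : x n = w (Fin.last n) := by simp [hxdef, Fin.last]
      rw [hs, Set.Finite.mem_toFinset] at hy
      have h1 := h x (by rw [hxn, hxy]; exact hy)
      rw [box_succ (by omega), ← hbox, hxw, hxy] at h1
      have h2 := congrArg ENNReal.toReal h1
      rw [ENNReal.toReal_mul, ENNReal.toReal_natCast] at h2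
      exact h2
  · intro w hw
    have hne : η (block (n + 1) ⁻¹' {w}) ≠ 0 := fun h => hw (by rw [measureReal_def, h]; rfl)
    have hfreq : ∃ᵐ a ∂η, a ∈ block (n + 1) ⁻¹' {w} := by
      rw [frequently_ae_mem_iff]; exact hne
    obtain ⟨a, haw, ha⟩ := (hfreq.and_eventually (hη n)).exists
    have hlast : a n = w (Fin.last n) := by
      have := congrFun haw (Fin.last n)
      simpa [block] using this
    have h1 := hF _ (hlast ▸ ha.left)
    rw [← h1, Set.ncard_eq_toFinset_card _ (Set.toFinite _)]
  · filter_upwards [hη n] with a ha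
    rw [hs, Set.Finite.mem_toFinset]
    simpa [block, follSet] using ha

end Block

/-! ### Paths driven by independent uniform choices -/

/-- The path from `b` that takes the followers numbered `w 0, w 1, …` in turn. -/
def walk {F : ℕ} (next : A → Fin F → A) (b : A) (w : ℕ → Fin F) : ℕ → A
  | 0 => b
  | n + 1 => next (walk next b w n) (w n)

/-- The point `s`, continued from cell `0` on by a path. -/
def pathPoint {F : ℕ} (next : A → Fin F → A) (s : ℤ → A) (w : ℕ → Fin F) : ℤ → A :=
  fun z => if z < 0 then s z else walk next (s 0) w z.toNat

lemma walk_congr {F : ℕ} (next : A → Fin F → A) (b : A) {w w' : ℕ → Fin F} {n : ℕ}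
    (h : ∀ i < n, w i = w' i) : walk next b w n = walk next b w' n := by
  induction n with
  | zero => rfl
  | succ n ih => rw [walk, walk, ih fun i hi => h i (by omega), h n (by omega)]

lemma pathPoint_congr {F : ℕ} (next : A → Fin F → A) (s : ℤ → A) {w w' : ℕ → Fin F} {n : ℕ}
    (h : ∀ i < n, w i = w' i) {z : ℤ} (hz : z ≤ n) :
    pathPoint next s w z = pathPoint next s w' z := by
  unfold pathPoint
  split_ifs with h0
  · rfl
  · exact walk_congr next _ fun i hi => h i (by omega)

lemma pathPoint_succ {F : ℕ} (next : A → Fin F → A) (s : ℤ → A) (w : ℕ → Fin F) (n : ℕ) :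
    pathPoint next s w (n + 1) = next (pathPoint next s w n) (w n) := by
  have h1 : ¬ ((n : ℤ) + 1 < 0) := by omega
  have h2 : ((n : ℤ) + 1).toNat = n + 1 := by omega
  have h3 : ¬ ((n : ℤ) < 0) := by omega
  simp [pathPoint, h1, h2, h3, walk]

section Existence
variable [Fintype A] [MeasurableSpace A] [MeasurableSingletonClass A]
  {R : Set (ℤ → A)} {F : ℕ}

/-- For admissible letters this enumerates the followers bijectively by `Fin F`, which turns uniform
transitions into independent uniform choices. Other letters get a constant placeholder. -/
lemma exists_next (hF : ∀ b, Adm1 R b → (follSet R b).ncard = F) :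
    ∃ next : A → Fin F → A, ∀ b, Adm1 R b → (∀ i, Adm2 R b (next b i)) ∧
      ∀ c, Adm2 R b c → ∃ j, ∀ i, next b i = c ↔ i = j := by
  have h : ∀ b, ∃ e : Fin F → A, Adm1 R b → (∀ i, Adm2 R b (e i)) ∧
      ∀ c, Adm2 R b c → ∃ j, ∀ i, e i = c ↔ i = j := by
    intro b
    by_cases hb : Adm1 R b
    · have e : Fin F ≃ follSet R b := by
        refine (Fintype.equivFinOfCardEq (α := (Set.toFinite (follSet R b)).toFinset) ?_).symm.trans
          (Equiv.subtypeEquivRight fun x => by simp)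
        rw [Fintype.card_coe, ← Set.ncard_eq_toFinset_card, hF b hb]
      refine ⟨fun i => e i, fun _ => ⟨fun i => (e i).2, fun c hc => ⟨e.symm ⟨c, hc⟩, fun i => ?_⟩⟩⟩
      rw [Equiv.eq_symm_apply, Subtype.ext_iff]
    · exact ⟨fun _ => b, fun h => absurd h hb⟩
  choose e he using h
  exact ⟨e, he⟩

/-- A Markov subshift with `F` followers for each letter carries a measure with uniform transitions
from cell `0` on. -/
lemma exists_unif_measure [TopologicalSpace A] (hR : IsMarkovSubshift R) (hne : R.Nonempty)
    (hF : ∀ b, Adm1 R b → (follSet R b).ncard = F) (hF0 : F ≠ 0) :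
    ∃ m : Measure (ℤ → A), IsProbabilityMeasure m ∧ (∀ᵐ a ∂m, ∀ z, Adm2 R (a z) (a (z + 1))) ∧
      ∀ n : ℕ, ∀ x : ℤ → A, Adm2 R (x n) (x (n + 1)) → ∀ u ≤ (n : ℤ),
        m (box u (n + 1) x) * F = m (box u n x) := by
  obtain ⟨s, hs⟩ := hne
  obtain ⟨next, hnext⟩ := exists_next hF
  have : NeZero F := ⟨hF0⟩
  set P : Measure (ℕ → Fin F) :=
    Measure.infinitePi fun _ => ProbabilityTheory.uniformOn (Set.univ : Set (Fin F)) with hP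
  have hPp : ∀ _ : ℕ, IsProbabilityMeasure
      (ProbabilityTheory.uniformOn (Set.univ : Set (Fin F))) := fun _ =>
    ProbabilityTheory.isProbabilityMeasure_uniformOn Set.finite_univ Set.univ_nonempty
  set T := pathPoint next s with hT
  have hTm : Measurable T := by
    refine measurable_pi_lambda _ fun z => ?_
    have h1 : (fun w => T w z) = (fun v : Fin z.toNat → Fin F =>
        T (fun i => if h : i < z.toNat then v ⟨i, h⟩ else 0) z) ∘ fun w i => w i := by
      funext w
      refine pathPoint_congr next s (n := z.toNat) (fun i hi => ?_) (by omega)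
      simp [hi]
    rw [h1]
    exact Measurable.of_discrete.comp (measurable_pi_lambda _ fun _ => measurable_pi_apply _)
  have hadmN : ∀ w : ℕ → Fin F, ∀ n : ℕ, Adm1 R (T w n) := by
    intro w n
    induction n with
    | zero => simpa [hT, pathPoint, walk] using adm1_of_mem hR.1.2 hs 0
    | succ n ih =>
      rw [Nat.cast_succ, hT, pathPoint_succ]
      exact ((hnext _ ih).1 (w n)).right hR.1.2
  have hadm : ∀ w, ∀ z, Adm2 R (T w z) (T w (z + 1)) := by
    intro w z
    rcases lt_or_ge z 0 with h | h
    · have h1 : T w z = s z := by simp [hT, pathPoint, h]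
      have h2 : T w (z + 1) = s (z + 1) := by
        rcases (Int.add_one_le_iff.2 h).eq_or_lt with h3 | h3
        · rw [h3]; simp [hT, pathPoint, walk]
        · simp [hT, pathPoint, h3]
      rw [h1, h2]
      exact adm2_of_mem hR.1.2 hs z
    · obtain ⟨n, rfl⟩ := Int.eq_ofNat_of_zero_le h
      rw [hT, pathPoint_succ]
      exact (hnext _ (hadmN w n)).1 (w n)
  refine ⟨P.map T, Measure.isProbabilityMeasure_map hTm.aemeasurable, ?_, fun n x hx u hu => ?_⟩
  · rw [ae_map_iff hTm.aemeasurable]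
    · exact Eventually.of_forall hadm
    · exact measurableSet_setOfPred.2 (Measurable.forall fun z =>
        measurableSet_setOfPred.1 (measurableSet_coord₂ (Adm2 R) _ _))
  · obtain ⟨j, hj⟩ := (hnext _ hx.left).2 _ hx
    have hpre : T ⁻¹' box u (n + 1) x = T ⁻¹' box u n x ∩ (fun w => w n) ⁻¹' {j} := by
      ext w
      rw [box_succ (by omega), Set.preimage_inter]
      refine and_congr_right fun hw => ?_
      have h1 : T w n = x n := hw n hu le_rfl
      change T w (n + 1) = x (n + 1) ↔ w n = j
      rw [← hj (w n), ← h1, hT, pathPoint_succ]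
    rw [Measure.map_apply hTm (measurableSet_box _ _ _),
      Measure.map_apply hTm (measurableSet_box _ _ _), hpre]
    -- The box up to cell `n` depends on the choices before `n`, while cell `n + 1` adds the
    -- independent choice number `n`, of probability `1 / F`.
    have hind : ProbabilityTheory.iIndepFun (fun (i : ℕ) (w : ℕ → Fin F) => w i) P :=
      ProbabilityTheory.iIndepFun_infinitePi (P := fun _ => ProbabilityTheory.uniformOn Set.univ)
        (X := fun _ (x : Fin F) => x) (fun _ => measurable_id)
    have hind2 := hind.indepFun_finset (Finset.range n) {n} (by simp)
      (fun i => measurable_pi_apply i)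
    have e1 : T ⁻¹' box u n x = (fun w (i : Finset.range n) => w i) ⁻¹'
        ((fun w (i : Finset.range n) => w i) '' (T ⁻¹' box u n x)) := by
      refine (Set.subset_preimage_image _ _).antisymm ?_
      rintro w ⟨w', hw', hww'⟩ z h1 h2
      rw [← hw' z h1 h2]
      exact pathPoint_congr next s
        (fun i hi => (congrFun hww' ⟨i, Finset.mem_range.2 hi⟩).symm) h2
    have e2 : (fun w : ℕ → Fin F => w n) ⁻¹' {j} =
        (fun w (i : ({n} : Finset ℕ)) => w i) ⁻¹' {v | v ⟨n, by simp⟩ = j} := rfl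
    rw [e1, e2, hind2.measure_inter_preimage_eq_mul _ _ (Set.toFinite _).measurableSet
      (Set.toFinite _).measurableSet, ← e1, ← e2]
    have e3 : P ((fun w : ℕ → Fin F => w n) ⁻¹' {j}) = (F : ENNReal)⁻¹ := by
      have h1 : Measurable fun w : ℕ → Fin F => w n := measurable_pi_apply n
      rw [← Measure.map_apply h1 (measurableSet_singleton j), hP]
      have h2 := Measure.infinitePi_map_eval
        (fun _ : ℕ => ProbabilityTheory.uniformOn (Set.univ : Set (Fin F))) n
      refine (congrArg (fun ν => ν {j}) h2).trans ?_
      simp only [ProbabilityTheory.uniformOn_univ]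
      simp
    rw [e3, mul_assoc, ENNReal.inv_mul_cancel (by exact_mod_cast hF0) (ENNReal.natCast_ne_top F),
      mul_one]

/-- A Markov subshift with `F` followers for each letter carries a shift-invariant measure of
entropy `log F`. -/
theorem exists_invariant_entropy [TopologicalSpace A] [DiscreteTopology A]
    (hR : IsMarkovSubshift R) (hne : R.Nonempty)
    (hF : ∀ b, Adm1 R b → (follSet R b).ncard = F) (hF0 : F ≠ 0) :
    ∃ ν : Measure (ℤ → A), IsInvariantOn R ν ∧ HasShiftEntropy ν (Real.log F) := by
  obtain ⟨m, hm, hmadm, hmbox⟩ := exists_unif_measure hR hne hF hF0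
  set mk : ℕ → Measure (ℤ → A) := fun k => m.map (translate (k : ℤ)) with hmk
  have hmkp : ∀ k, IsProbabilityMeasure (mk k) := fun k =>
    Measure.isProbabilityMeasure_map (measurable_translate _).aemeasurable
  set c : ℕ → ENNReal := fun n => ((n + 1 : ℕ) : ENNReal)⁻¹ with hc
  -- Averages along the orbit of `m`, as in the Krylov–Bogoliubov theorem. Translation moves the
  -- start of the uniform transitions to the left, so every average has them from cell 0 on.
  set νs : ℕ → Measure (ℤ → A) := fun n => c n • ∑ k ∈ Finset.range (n + 1), mk k with hνs
  have hνsp : ∀ n, IsProbabilityMeasure (νs n) := by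
    intro n
    constructor
    rw [hνs, Measure.smul_apply, Measure.finsetSum_apply]
    simp only [measure_univ, Finset.sum_const, Finset.card_range, smul_eq_mul, nsmul_eq_mul,
      mul_one, hc]
    exact ENNReal.inv_mul_cancel (by simp) (ENNReal.natCast_ne_top _)
  set νp : ℕ → ProbabilityMeasure (ℤ → A) := fun n => ⟨νs n, hνsp n⟩ with hνp
  -- Compactness of the space of probability measures gives a limit along a nonprincipal
  -- ultrafilter, which avoids passing to subsequences.
  obtain ⟨ν, hν⟩ : ∃ ν : ProbabilityMeasure (ℤ → A), Tendsto νp (hyperfilter ℕ) (𝓝 ν) :=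
    ⟨_, ((hyperfilter ℕ).map νp).le_nhds_lim⟩
  -- Clopen sets have empty frontier, so weak convergence gives convergence of their measures. Boxes
  -- and conditions on two cells are clopen.
  have hlim : ∀ C : Set (ℤ → A), IsClopen C →
      Tendsto (fun n => νs n C) (hyperfilter ℕ) (𝓝 ((ν : Measure (ℤ → A)) C)) := fun C hC =>
    ProbabilityMeasure.tendsto_measure_of_null_frontier_of_tendsto' hν (by
      rw [hC.frontier_eq]; exact measure_empty)
  have hclopen_coord : ∀ (P : A → A → Prop) (z w : ℤ), IsClopen {a : ℤ → A | P (a z) (a w)} := by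
    intro P z w
    have h1 : Continuous fun a : ℤ → A => (a z, a w) := by fun_prop
    exact (isClopen_discrete {x : A × A | P x.1 x.2}).preimage h1
  have hclopen_box : ∀ u v x, IsClopen (box u v x : Set (ℤ → A)) := by
    intro u v x
    have : (box u v x : Set (ℤ → A)) =
        ⋂ z ∈ Finset.Icc u v, (fun a : ℤ → A => a z) ⁻¹' {x z} := by
      ext a; simp [box]
    rw [this]
    exact isClopen_biInter_finset fun z _ => (isClopen_discrete {x z}).preimage (continuous_apply z)
  have hadm : ∀ z : ℤ, ∀ᵐ a ∂(ν : Measure (ℤ → A)), Adm2 R (a z) (a (z + 1)) := by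
    intro z
    have h0 : ∀ n, νs n {a | ¬ Adm2 R (a z) (a (z + 1))} = 0 := by
      intro n
      rw [hνs, Measure.smul_apply, Measure.finsetSum_apply, Finset.sum_eq_zero, smul_zero]
      intro k _
      rw [hmk, Measure.map_apply (measurable_translate _)
        (measurableSet_coord₂ (fun x y => ¬ Adm2 R x y) _ _)]
      refine measure_eq_zero_iff_ae_notMem.2 ?_
      filter_upwards [hmadm] with a ha hcon
      refine hcon ?_
      simpa [add_right_comm] using ha (z + k)
    have h1 := hlim _ (hclopen_coord (fun x y => ¬ Adm2 R x y) z (z + 1))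
    simp only [h0] at h1
    exact ae_iff.2 (tendsto_nhds_unique h1 tendsto_const_nhds)
  have hbox : ∀ n : ℕ, ∀ x : ℤ → A, Adm2 R (x n) (x (n + 1)) →
      (ν : Measure (ℤ → A)) (box 0 (n + 1) x) * F = (ν : Measure (ℤ → A)) (box 0 n x) := by
    intro n x hx
    have hpre : ∀ (k : ℕ) (v : ℤ), translate (k : ℤ) ⁻¹' box 0 v x =
        box k (v + k) (translate (-(k : ℤ)) x) := by
      intro k v
      ext a
      simp only [Set.mem_preimage, box, Set.mem_ofPred_eq, translate_apply]
      refine ⟨fun h z h1 h2 => ?_, fun h z h1 h2 => ?_⟩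
      · have := h (z + -k) (by omega) (by omega)
        rwa [neg_add_cancel_right] at this
      · have := h (z + k) (by omega) (by omega)
        rwa [add_neg_cancel_right] at this
    have h0 : ∀ N, νs N (box 0 (n + 1) x) * F = νs N (box 0 n x) := by
      intro N
      simp only [hνs, Measure.smul_apply, Measure.finsetSum_apply, smul_eq_mul]
      rw [mul_assoc, Finset.sum_mul]
      congr 1
      refine Finset.sum_congr rfl fun k _ => ?_
      rw [hmk, Measure.map_apply (measurable_translate _) (measurableSet_box _ _ _),
        Measure.map_apply (measurable_translate _) (measurableSet_box _ _ _), hpre, hpre]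
      have := hmbox (n + k) (translate (-(k : ℤ)) x) ?_ k (by push_cast; omega)
      · push_cast at this
        rwa [add_right_comm] at this
      · push_cast
        simpa [add_right_comm] using hx
    have h1 := ENNReal.Tendsto.mul_const (hlim _ (hclopen_box 0 (n + 1) x))
      (b := (F : ENNReal)) (Or.inr (ENNReal.natCast_ne_top F))
    simp only [h0] at h1
    exact tendsto_nhds_unique h1 (hlim _ (hclopen_box 0 n x))
  have hclim : Tendsto c (hyperfilter ℕ) (𝓝 0) := by
    have h1 : Tendsto c atTop (𝓝 0) :=
      ENNReal.tendsto_inv_nat_nhds_zero.comp (tendsto_add_atTop_nat 1)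
    exact h1.mono_left Nat.hyperfilter_le_atTop
  have hinv : (ν : Measure (ℤ → A)).map shift = ν := by
    have : IsProbabilityMeasure ((ν : Measure (ℤ → A)).map shift) :=
      Measure.isProbabilityMeasure_map measurable_shift.aemeasurable
    refine measure_ext_of_box 0 fun k _ x => ?_
    rw [Measure.map_apply measurable_shift (measurableSet_box _ _ _)]
    set C := (box (-k) k x : Set (ℤ → A))
    have hC : MeasurableSet C := measurableSet_box _ _ _
    have hcont : Continuous (shift : (ℤ → A) → _) :=
      continuous_pi fun z => continuous_apply (z + 1)
    have hCc : IsClopen C := hclopen_box _ _ _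
    have hstep : ∀ k, mk k (shift ⁻¹' C) = mk (k + 1) C := by
      intro k
      rw [hmk, Measure.map_apply (measurable_translate _) (measurable_shift hC),
        Measure.map_apply (measurable_translate _) hC, ← Set.preimage_comp]
      congr 2
      funext a
      simp [shift_eq_translate, translate_translate, add_comm]
    -- Shifting an average changes only its two end terms, whose weight `c n` tends to 0.
    have htel : ∀ n, νs n (shift ⁻¹' C) + c n * mk 0 C = νs n C + c n * mk (n + 1) C := by
      intro n
      simp only [hνs, Measure.smul_apply, Measure.finsetSum_apply, smul_eq_mul, hstep, ← mul_add]
      rw [← Finset.sum_range_succ (fun k => mk k C), Finset.sum_range_succ' (fun k => mk k C)]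
    have hsmall : ∀ g : ℕ → ℕ, Tendsto (fun n => c n * mk (g n) C) (hyperfilter ℕ) (𝓝 0) :=
      fun g => tendsto_of_tendsto_of_tendsto_of_le_of_le tendsto_const_nhds hclim
        (fun _ => zero_le) fun n => mul_le_of_le_one_right' prob_le_one
    have h1 := (hlim _ (hCc.preimage hcont)).add (hsmall fun _ => 0)
    have h2 := (hlim _ hCc).add (hsmall fun n => n + 1)
    simp only [htel, add_zero] at h1 h2
    exact tendsto_nhds_unique h1 h2
  refine ⟨ν, ⟨inferInstance, ?_, hinv⟩, ?_⟩
  · filter_upwards [ae_all_iff.2 hadm] with a ha using (hR.mem_iff a).2 ha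
  · have hH : ∀ n, blockEntropy (ν : Measure (ℤ → A)) (n + 1) =
        blockEntropy (ν : Measure (ℤ → A)) 1 + n * Real.log F := by
      intro n
      induction n with
      | zero => simp
      | succ n ih =>
        rw [(blockEntropy_succ_le hF hF0 hadm n).2.2 (hbox n), ih]
        push_cast; ring
    have h1 : Tendsto (fun n : ℕ => blockEntropy (ν : Measure (ℤ → A)) 1 / (n + 1 : ℕ) +
        (1 - 1 / ((n : ℝ) + 1)) * Real.log F) atTop (𝓝 (0 + (1 - 0) * Real.log F)) := by
      refine Tendsto.add ?_ ((tendsto_const_nhds.sub tendsto_one_div_add_atTop_nhds_zero_nat).mul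
        tendsto_const_nhds)
      exact (tendsto_const_div_atTop_nhds_zero_nat _).comp (tendsto_add_atTop_nat 1)
    rw [zero_add, sub_zero, one_mul] at h1
    refine (tendsto_add_atTop_iff_nat 1).1 (h1.congr fun n => ?_)
    rw [hH n]
    push_cast
    field_simp
    ring

/-- Parry measures on right-regular Markov subshifts have uniform transitions. -/
theorem IsParryMeasure.unifFrom [TopologicalSpace A] [DiscreteTopology A]
    (hR : IsMarkovSubshift R) (hF : ∀ b, Adm1 R b → (follSet R b).ncard = F) (hF0 : F ≠ 0)
    {η : Measure (ℤ → A)} (h : IsParryMeasure R η) (f : ℤ) : UnifFrom R F f η := by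
  obtain ⟨⟨hη, hηR, hinv⟩, h, hent, hmax⟩ := h
  have hadm : ∀ z : ℤ, ∀ᵐ a ∂η, Adm2 R (a z) (a (z + 1)) := fun z => by
    filter_upwards [hηR] with a ha using adm2_of_mem hR.1.2 ha z
  obtain ⟨a₀, ha₀⟩ := hηR.exists
  obtain ⟨ν, hν, hνent⟩ := exists_invariant_entropy hR ⟨a₀, ha₀⟩ hF hF0
  have hle := hmax ν _ hν hνent
  -- `H` is squeezed: subadditivity puts its growth rate `h ≥ log F` below every `H n / n`, while
  -- each increment is at most `log F`. Hence `H n = n * log F` for all `n`.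
  set H : ℕ → ℝ := fun n => blockEntropy η (n + 1) - blockEntropy η 1 with hH
  have hsub : Subadditive H := by
    intro m n
    have := blockEntropy_add_le hinv m n
    simp only [hH]
    linarith
  have hlimH : Tendsto (fun n : ℕ => H n / n) atTop (𝓝 h) := by
    have h1 := (tendsto_add_atTop_iff_nat 1).2 hent
    have h2 : Tendsto (fun n : ℕ => ((n + 1 : ℕ) : ℝ) / n) atTop (𝓝 1) := by
      have := (tendsto_const_nhds (x := (1 : ℝ))).add (tendsto_const_div_atTop_nhds_zero_nat 1)
      rw [add_zero] at this
      refine this.congr' ?_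
      filter_upwards [eventually_ne_atTop 0] with n hn
      push_cast
      field_simp
    have h3 := (h1.mul h2).sub (tendsto_const_div_atTop_nhds_zero_nat (blockEntropy η 1))
    rw [mul_one, sub_zero] at h3
    refine h3.congr' ?_
    filter_upwards [eventually_ne_atTop 0] with n hn
    simp only [hH]
    field_simp
  have hlow : ∀ n, n * Real.log F ≤ H n := by
    intro n
    rcases Nat.eq_zero_or_pos n with rfl | hn
    · simp [hH]
    have h1 : Tendsto (fun k : ℕ => H (k * n) / (k * n : ℕ)) atTop (𝓝 h) :=
      hlimH.comp (tendsto_id.atTop_mul_const' hn)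
    have h2 : h ≤ H n / n := by
      refine le_of_tendsto h1 ?_
      filter_upwards [eventually_gt_atTop 0] with k hk
      have h3 := hsub.apply_mul_add_le k n 0
      have h4 : H 0 = 0 := by simp [hH]
      rw [add_zero, h4, add_zero] at h3
      have h5 : (0 : ℝ) < k := by exact_mod_cast hk
      have h6 : (0 : ℝ) < n := by exact_mod_cast hn
      push_cast
      rw [div_le_div_iff₀ (by positivity) h6]
      nlinarith
    have h6 : (0 : ℝ) < n := by exact_mod_cast hn
    have h7 := (le_div_iff₀ h6).1 (hle.trans h2)
    linarith
  have hstep := fun n => blockEntropy_succ_le hF hF0 hadm n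
  have hup : ∀ n, H n ≤ n * Real.log F := by
    intro n
    induction n with
    | zero => simp [hH]
    | succ n ih =>
      have := (hstep n).1
      simp only [hH] at ih ⊢
      push_cast
      linarith
  have heq : ∀ n : ℕ, ∀ x : ℤ → A, Adm2 R (x n) (x (n + 1)) →
      η (box 0 (n + 1) x) * F = η (box 0 n x) := by
    intro n
    refine (hstep n).2.1 ?_
    have h1 := le_antisymm (hup n) (hlow n)
    have h2 := le_antisymm (hup (n + 1)) (hlow (n + 1))
    simp only [hH] at h1 h2
    push_cast at h2
    linarith
  refine UnifFrom.of_box (fun n _ => hadm n) fun n _ u hu x hx => ?_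
  -- Equality was obtained for boxes starting at cell 0; shift-invariance transfers it to all boxes.
  have hbox : ∀ v, η (box u v x) = η (box 0 (v - u) (translate u x)) := by
    intro v
    conv_lhs => rw [← map_translate_int hinv (-u)]
    rw [Measure.map_apply (measurable_translate _) (measurableSet_box _ _ _)]
    congr 1
    ext a
    simp only [Set.mem_preimage, box, Set.mem_ofPred_eq, translate_apply]
    refine ⟨fun h z h1 h2 => ?_, fun h z h1 h2 => ?_⟩
    · have := h (z + u) (by omega) (by omega)
      rwa [add_neg_cancel_right] at this
    · have := h (z + -u) (by omega) (by omega)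
      rwa [neg_add_cancel_right] at this
  obtain ⟨k, hk⟩ : ∃ k : ℕ, n - u = k := Int.eq_ofNat_of_zero_le (sub_nonneg.2 hu)
  have h1 : n + 1 - u = k + 1 := by rw [add_sub_right_comm, hk]
  have h2 : (k : ℤ) + u = n := by omega
  rw [hbox, hbox, h1, hk]
  refine heq k _ ?_
  rw [translate_apply, translate_apply, h2, add_right_comm, h2]
  exact hx

end Existence

/-! ### Reflection -/

/-- The reflection of the lattice. -/
def refl (a : ℤ → A) : ℤ → A := fun z => a (-z)

@[simp] lemma refl_apply (a : ℤ → A) (z : ℤ) : refl a z = a (-z) := rfl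

@[simp] lemma refl_refl (a : ℤ → A) : refl (refl a) = a := by
  funext z; simp

lemma refl_translate (k : ℤ) (a : ℤ → A) : refl (translate k a) = translate (-k) (refl a) := by
  funext z; simp [add_comm]

/-- The mirror image of a local rule. -/
def reflRule (φ : A → A → A → A) : A → A → A → A := fun x y z => φ z y x

lemma caMap_reflRule (φ : A → A → A → A) (a : ℤ → A) :
    caMap (reflRule φ) (refl a) = refl (caMap φ a) := by
  funext z
  simp only [caMap, reflRule, refl_apply]
  congr 2 <;> ring_nf

lemma iterate_caMap_reflRule (φ : A → A → A → A) (t : ℕ) (a : ℤ → A) :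
    (caMap (reflRule φ))^[t] (refl a) = refl ((caMap φ)^[t] a) := by
  induction t with
  | zero => rfl
  | succ t ih => rw [Function.iterate_succ_apply', Function.iterate_succ_apply', ih,
      caMap_reflRule]

lemma measurable_refl [MeasurableSpace A] : Measurable (refl : (ℤ → A) → _) :=
  measurable_pi_lambda _ fun _ => measurable_pi_apply _

/-- Reflection, as a measurable equivalence. -/
def reflEquiv [MeasurableSpace A] : (ℤ → A) ≃ᵐ (ℤ → A) where
  toFun := refl
  invFun := refl
  left_inv := refl_refl
  right_inv := refl_refl
  measurable_toFun := measurable_refl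
  measurable_invFun := measurable_refl

/-- The mirror image of a set of sequences. -/
def reflSet (S : Set (ℤ → A)) : Set (ℤ → A) := {a | refl a ∈ S}

lemma mem_reflSet {S : Set (ℤ → A)} {a : ℤ → A} : a ∈ reflSet S ↔ refl a ∈ S := Iff.rfl

lemma reflSet_reflSet (S : Set (ℤ → A)) : reflSet (reflSet S) = S := by
  ext a; simp [mem_reflSet]

section
variable {S : Set (ℤ → A)}

lemma shift_image_reflSet (hS : shift '' S = S) : shift '' reflSet S = reflSet S := by
  apply Set.Subset.antisymm
  · rintro _ ⟨a, ha, rfl⟩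
    rw [mem_reflSet, shift_eq_translate, refl_translate]
    exact translate_mem hS ha _
  · intro a ha
    refine ⟨translate (-1) a, ?_, by simp [shift_eq_translate, translate_translate]⟩
    rw [mem_reflSet, refl_translate]
    exact translate_mem hS ha _

lemma adm2_of_adm2_reflSet (hS : shift '' S = S) {a b : A} (h : Adm2 (reflSet S) a b) :
    Adm2 S b a := by
  obtain ⟨s, hs, rfl, rfl⟩ := h
  simpa using adm2_of_mem hS hs (-1)

lemma adm2_reflSet_iff (hS : shift '' S = S) {a b : A} :
    Adm2 (reflSet S) a b ↔ Adm2 S b a := by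
  refine ⟨adm2_of_adm2_reflSet hS, fun h => ?_⟩
  refine adm2_of_adm2_reflSet (shift_image_reflSet hS) ?_
  rwa [reflSet_reflSet]

lemma adm1_of_adm1_reflSet {a : A} (h : Adm1 (reflSet S) a) : Adm1 S a := by
  obtain ⟨s, hs, rfl⟩ := h
  exact ⟨_, hs, by simp⟩

lemma adm3_of_adm3_reflSet (hS : shift '' S = S) {a b c : A} (h : Adm3 (reflSet S) a b c) :
    Adm3 S c b a := by
  obtain ⟨s, hs, rfl, rfl, rfl⟩ := h
  exact ⟨_, translate_mem hS hs (-2), by simp, by simp, by simp⟩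

lemma follSet_reflSet (hS : shift '' S = S) (b : A) : follSet (reflSet S) b = predSet S b := by
  ext a
  exact adm2_reflSet_iff hS

lemma IsMarkovSubshift.reflSet [TopologicalSpace A] (hS : IsMarkovSubshift S) :
    IsMarkovSubshift (reflSet S) := by
  have hcont : Continuous (refl : (ℤ → A) → _) := continuous_pi fun z => continuous_apply (-z)
  refine ⟨⟨hS.1.1.preimage hcont, shift_image_reflSet hS.1.2⟩, ?_⟩
  ext a
  rw [mem_reflSet, hS.mem_iff]
  simp only [Set.mem_ofPred_eq, adm2_reflSet_iff hS.1.2, refl_apply]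
  refine ⟨fun h z => ?_, fun h z => ?_⟩
  · have := h (-z - 1)
    rwa [show -(-z - 1) = z + 1 by ring, show -(-z - 1 + 1) = z by ring] at this
  · have := h (-z - 1)
    rw [neg_add, ← sub_eq_add_neg]
    simpa using this

lemma mapsTo_reflSet {φ : A → A → A → A} (h : Set.MapsTo (caMap φ) S S) :
    Set.MapsTo (caMap (reflRule φ)) (reflSet S) (reflSet S) := by
  intro a ha
  have := h ha
  rw [mem_reflSet, ← refl_refl a, caMap_reflRule, refl_refl]
  exact this

lemma IsLeftResolving.reflSet {φ : A → A → A → A} (hS : shift '' S = S)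
    (h : IsLeftResolving φ S) : IsRightResolving (reflRule φ) (reflSet S) := by
  refine ⟨mapsTo_reflSet h.1, fun a b c habc => ?_⟩
  rw [follSet_reflSet hS]
  exact h.2 c b a (adm3_of_adm3_reflSet hS habc)

end

/-! ### Reflection of Parry measures. -/

section Parry
variable [Fintype A] [MeasurableSpace A] [MeasurableSingletonClass A] {S : Set (ℤ → A)}
  {η : Measure (ℤ → A)}

lemma map_refl_map_refl (η : Measure (ℤ → A)) : (η.map refl).map refl = η := by
  rw [Measure.map_map measurable_refl measurable_refl]
  have : (refl ∘ refl : (ℤ → A) → _) = id := funext refl_refl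
  rw [this, Measure.map_id]

lemma IsMarkovSubshift.measurableSet [TopologicalSpace A] (hS : IsMarkovSubshift S) :
    MeasurableSet S := by
  rw [hS.2]
  exact measurableSet_setOfPred.2 (Measurable.forall fun z =>
    measurableSet_setOfPred.1 (measurableSet_coord₂ (Adm2 S) _ _))

lemma IsInvariantOn.map_refl [TopologicalSpace A] (hS : IsMarkovSubshift S)
    (h : IsInvariantOn S η) : IsInvariantOn (reflSet S) (η.map refl) := by
  obtain ⟨hp, hη, hinv⟩ := h
  refine ⟨Measure.isProbabilityMeasure_map measurable_refl.aemeasurable, ?_, ?_⟩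
  · refine (ae_map_iff measurable_refl.aemeasurable (p := (· ∈ reflSet S))
      hS.reflSet.measurableSet).2 ?_
    filter_upwards [hη] with a ha
    simpa [mem_reflSet] using ha
  · conv_rhs => rw [← map_translate_int hinv (-1)]
    rw [Measure.map_map measurable_shift measurable_refl,
      Measure.map_map measurable_refl (measurable_translate _)]
    congr 1
    funext a
    simp [shift_eq_translate, refl_translate]

/-- Reflection reads the block in coordinates `1 - n, …, 0` backwards. Invariance moves this block
back to `0, …, n - 1`, and reversing a word is injective. -/
lemma blockEntropy_map_refl (hη : η.map shift = η) (n : ℕ) :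
    blockEntropy (η.map refl) n = blockEntropy η n := by
  rw [blockEntropy_eq, blockEntropy_eq]
  have h1 : entropyOf (η.map refl) (block n) = entropyOf η fun a => block n (refl a) := by
    refine Finset.sum_congr rfl fun v _ => ?_
    rw [map_measureReal_apply measurable_refl (measurable_block n (measurableSet_singleton v))]
    rfl
  rw [h1, ← entropyOf_comp_invariant (measurable_translate (1 - (n : ℤ)))
    (map_translate_int hη _) (measurable_block (A := A) n),
    ← entropyOf_comp_injective η (fun a : ℤ → A => block n (translate (1 - (n : ℤ)) a))
      (e := fun w i => w (Fin.rev i))]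
  · congr 1
    funext a i
    simp only [block, refl_apply, translate_apply, Fin.val_rev]
    congr 1
    have := i.2
    omega
  · intro w w' h
    funext i
    have := congrFun h (Fin.rev i)
    simpa using this

lemma IsParryMeasure.map_refl [TopologicalSpace A] (hS : IsMarkovSubshift S)
    (h : IsParryMeasure S η) : IsParryMeasure (reflSet S) (η.map refl) := by
  obtain ⟨hinv, c, hc, hmax⟩ := h
  have hent : ∀ {ν : Measure (ℤ → A)} {c : ℝ}, ν.map shift = ν → HasShiftEntropy ν c →
      HasShiftEntropy (ν.map refl) c := by
    intro ν c hν h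
    simpa only [HasShiftEntropy, blockEntropy_map_refl hν] using h
  refine ⟨hinv.map_refl hS, c, hent hinv.2.2 hc, fun ν c' hν hc' => ?_⟩
  -- A competitor on the reflected subshift is reflected back to a competitor of the same entropy on
  -- `S`.
  refine hmax (ν.map refl) c' ?_ (hent hν.2.2 hc')
  have := hν.map_refl hS.reflSet
  rwa [reflSet_reflSet] at this

end Parry

/-! ### The product measure -/

lemma winHi_eq (W : ℕ) : winHi W = winLo W + W - 1 := by
  unfold winHi winLo; omega

lemma glue_of_gt {W : ℕ} {l : ℤ → A} {d : Fin W → A} {r : ℤ → A} {z : ℤ} (hz : winHi W < z) :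
    glue W l d r z = r (z - winHi W) := by
  have := winHi_eq W
  rw [glue, if_neg (by omega), dif_neg (by omega)]

lemma glue_of_lt {W : ℕ} {l : ℤ → A} {d : Fin W → A} {r : ℤ → A} {z : ℤ} (hz : z < winLo W) :
    glue W l d r z = l (z - winLo W) := by
  rw [glue, if_pos hz]

lemma glue_congr_left {W : ℕ} {l l' : ℤ → A} {d : Fin W → A} {r : ℤ → A} {z : ℤ}
    (hz : winLo W ≤ z) : glue W l d r z = glue W l' d r z := by
  rw [glue, glue, if_neg hz.not_gt, if_neg hz.not_gt]

lemma glue_congr_right {W : ℕ} {l : ℤ → A} {d : Fin W → A} {r r' : ℤ → A} {z : ℤ}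
    (hz : z ≤ winHi W) : glue W l d r z = glue W l d r' z := by
  have := winHi_eq W
  rw [glue, glue]
  split_ifs with h1 h2
  · rfl
  · rfl
  · omega

section Product
variable [Fintype A] [MeasurableSpace A] [MeasurableSingletonClass A] {R : Set (ℤ → A)} {F : ℕ}

/-- If the cells from `f` on are those of a random sequence with uniform transitions that is
independent of the other cells, then the joint law has uniform transitions from `f` on. -/
lemma unifFrom_map_prod {Y : Type*} [MeasurableSpace Y] {η : Measure (ℤ → A)}
    [IsProbabilityMeasure η] (hη : ∀ f, UnifFrom R F f η) (θ : Measure Y)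
    [IsProbabilityMeasure θ] {G : (ℤ → A) × Y → (ℤ → A)} (hG : Measurable G) {f k : ℤ}
    {H : Y → ℤ → A} (hGf : ∀ x z, f ≤ z → G x z = x.1 (z - k))
    (hGH : ∀ x z, z < f → G x z = H x.2 z) : UnifFrom R F f ((η.prod θ).map G) := by
  have : IsProbabilityMeasure ((η.prod θ).map G) := Measure.isProbabilityMeasure_map hG.aemeasurable
  refine UnifFrom.of_box (fun n hn => ?_) fun n hn u hu x hx => ?_
  · rw [ae_map_iff hG.aemeasurable (measurableSet_coord₂ (Adm2 R) _ _)]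
    have h1 := Measure.quasiMeasurePreserving_fst (μ := η) (ν := θ) |>.ae
      ((hη (n - k)).adm (n - k) le_rfl)
    filter_upwards [h1] with y hy
    rw [hGf _ _ hn, hGf _ _ (by omega), add_sub_right_comm]
    exact hy
  -- A box splits into a condition on the random sequence and one on the independent remainder, so
  -- its measure factors; extending the box affects only the first factor.
  · have hpre : ∀ v, f ≤ v → G ⁻¹' box u v x = box (max u f - k) (v - k) (translate k x) ×ˢ
        {y | ∀ z, u ≤ z → z < f → H y z = x z} := by
      intro v hv
      ext y
      simp only [Set.mem_preimage, box, Set.mem_ofPred_eq, Set.mem_prod, translate_apply]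
      refine ⟨fun h => ⟨fun z h1 h2 => ?_, fun z h1 h2 => ?_⟩, fun h z h1 h2 => ?_⟩
      · have h3 := h (z + k) (by omega) (by omega)
        rwa [hGf _ _ (by omega), add_sub_cancel_right] at h3
      · rw [← hGH _ _ h2]
        exact h z h1 (by omega)
      · rcases lt_or_ge z f with h3 | h3
        · rw [hGH _ _ h3]; exact h.2 z h1 h3
        · rw [hGf _ _ h3, h.1 (z - k) (by omega) (by omega), sub_add_cancel]
    rw [Measure.map_apply hG (measurableSet_box _ _ _),
      Measure.map_apply hG (measurableSet_box _ _ _), hpre _ hn, hpre _ (by omega),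
      Measure.prod_prod, Measure.prod_prod, mul_right_comm, add_sub_right_comm]
    congr 1
    rw [box_succ (by omega)]
    refine (hη (n - k)).unif (n - k) le_rfl _ (measurableSet_box _ _ _) (detBy_box _ _ _) _
      fun a ha => ?_
    rw [ha (n - k) (by omega) le_rfl]
    simpa [sub_add_eq_add_sub] using hx

lemma measurable_glue (W : ℕ) : Measurable fun x : (ℤ → A) × (Fin W → A) × (ℤ → A) =>
    glue W x.1 x.2.1 x.2.2 := by
  refine measurable_pi_lambda _ fun z => ?_
  unfold glue
  split_ifs <;> fun_prop

/-- The factors are reordered to match `unifFrom_map_prod`. The point `r₀` is arbitrary, since cells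
up to the right end of the window ignore the right factor. -/
lemma unifFrom_productMeasure {W : ℕ} {lam rho : Measure (ℤ → A)} {δ : Measure (Fin W → A)}
    [IsProbabilityMeasure lam] [IsProbabilityMeasure rho] [IsProbabilityMeasure δ]
    (hrho : ∀ f, UnifFrom R F f rho) :
    UnifFrom R F (winHi W + 1) (productMeasure W lam δ rho) := by
  obtain ⟨r₀⟩ := nonempty_of_isProbabilityMeasure rho
  have hm : Measurable fun y : (ℤ → A) × (ℤ → A) × (Fin W → A) => (y.2.1, y.2.2, y.1) := by
    fun_prop
  have hprod : lam.prod (δ.prod rho) = (rho.prod (lam.prod δ)).map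
      fun y => (y.2.1, y.2.2, y.1) := by
    rw [← Measure.prodAssoc_prod, ← Measure.prod_swap (μ := rho) (ν := lam.prod δ),
      Measure.map_map (MeasurableEquiv.measurable _) measurable_swap]
    rfl
  rw [productMeasure, hprod, Measure.map_map (measurable_glue W) hm]
  refine unifFrom_map_prod hrho _ ((measurable_glue W).comp hm) (k := winHi W)
    (H := fun y => glue W y.1 y.2 r₀) (fun x z hz => glue_of_gt (by omega))
    fun x z hz => glue_congr_right (by omega)

lemma unifFrom_productMeasure_refl {W : ℕ} {lam rho : Measure (ℤ → A)} {δ : Measure (Fin W → A)}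
    [IsProbabilityMeasure lam] [IsProbabilityMeasure rho] [IsProbabilityMeasure δ]
    (hlam : ∀ f, UnifFrom R F f (lam.map refl)) :
    UnifFrom R F (1 - winLo W) ((productMeasure W lam δ rho).map refl) := by
  obtain ⟨l₀⟩ := nonempty_of_isProbabilityMeasure lam
  have : IsProbabilityMeasure (lam.map refl) :=
    Measure.isProbabilityMeasure_map measurable_refl.aemeasurable
  have hm : Measurable (Prod.map refl id : (ℤ → A) × ((Fin W → A) × (ℤ → A)) → _) :=
    measurable_refl.prodMap measurable_id
  have hprod : lam.prod (δ.prod rho) = ((lam.map refl).prod (δ.prod rho)).map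
      (Prod.map refl id) := by
    rw [← Measure.map_prod_map _ _ measurable_refl measurable_id, map_refl_map_refl,
      Measure.map_id]
  rw [productMeasure, hprod, Measure.map_map measurable_refl (measurable_glue W),
    Measure.map_map (measurable_refl.comp (measurable_glue W)) hm]
  refine unifFrom_map_prod hlam _ ((measurable_refl.comp (measurable_glue W)).comp hm)
    (k := -winLo W) (H := fun y => refl (glue W l₀ y.1 y.2)) (fun x z hz => ?_)
    fun x z hz => ?_
  · simp only [Function.comp_apply, refl_apply, Prod.map]
    rw [glue_of_lt (by omega), refl_apply]
    rw [show -(-z - winLo W) = z - -winLo W by ring]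
  · simp only [Function.comp_apply, refl_apply, Prod.map]
    exact glue_congr_left (by omega)

end Product

/-! ### Particles in the sense of the definition are localized -/

section Particle
variable {S L R : Set (ℤ → A)} {W q : ℕ} {a : ℤ → A} {φ : A → A → A → A}

lemma eq_add_of_shift_iterate {l : ℤ → A} (h : shift^[q] l = l) (z : ℤ) : l (z + q) = l z := by
  have key : ∀ (n : ℕ) (z : ℤ), shift^[n] l z = l (z + n) := by
    intro n
    induction n with
    | zero => simp
    | succ n ih =>
      intro z
      rw [Function.iterate_succ_apply', shift, ih]
      push_cast
      congr 1; ring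
  rw [← key, h]

lemma HasDefect.isLeast_isGreatest (h : HasDefect S L R W a) :
    IsLeast (defectSet S a) (defectLeft S a) ∧ IsGreatest (defectSet S a) (defectRight S a) :=
  ⟨⟨Int.csInf_mem h.1 h.2.1, fun _ hj => csInf_le h.2.1 hj⟩,
    ⟨Int.csSup_mem h.1 h.2.2.1, fun _ hj => le_csSup h.2.2.1 hj⟩⟩

/-- The window lies within distance about `W` of the leftmost defect, so `2 * W + 3` is a
comfortable bound that leaves room for all roundings. -/
lemma HasDefect.isLocalized (hR : shift '' R = R) (hL : ∀ l ∈ L, shift^[q] l = l)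
    (h : HasDefect S L R W a) : IsLocalized S R q (2 * W + 3) (defectLeft S a) a := by
  obtain ⟨hl, hr⟩ := h.isLeast_isGreatest
  obtain ⟨-, -, -, hw, ⟨l, hlL, hla⟩, ⟨r, hrR, hra⟩⟩ := h
  have hlr := hl.2 hr.1
  have hpos : defectPos S a = defectLeft S a + (defectWidth S a + 1) / 2 := rfl
  have hwd : defectWidth S a = defectRight S a - defectLeft S a := rfl
  have hlo : winLo W = 1 - ((W : ℤ) + 1) / 2 := rfl
  have hhi : winHi W = (W : ℤ) / 2 := rfl
  refine ⟨hl, fun j hj => ?_, fun z hz => ?_, fun z hz => ?_⟩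
  · have := hr.2 hj; omega
  · obtain ⟨n, hn⟩ := Int.eq_ofNat_of_zero_le (a := defectPos S a + winLo W - z) (by omega)
    have e1 := hla n (by omega)
    have e2 := hla (n + q) (by omega)
    rw [show defectPos S a + winLo W - n = z by omega] at e1
    rw [show defectPos S a + winLo W - (n + q : ℕ) = z - q by push_cast; omega] at e2
    rw [e1, e2, ← eq_add_of_shift_iterate (hL l hlL)]
    congr 1; push_cast; ring
  · obtain ⟨n, hn⟩ := Int.eq_ofNat_of_zero_le (a := z - (defectPos S a + winHi W)) (by omega)
    have e1 := hra n (by omega)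
    have e2 := hra (n + 1) (by omega)
    rw [show defectPos S a + winHi W + n = z by omega] at e1
    rw [show defectPos S a + winHi W + (n + 1 : ℕ) = z + 1 by push_cast; omega] at e2
    rw [e1, e2]
    exact_mod_cast adm2_of_mem hR hrR n

/-- A transition is indexed by its left cell; under reflection the pair `(j, j + 1)` comes from `(-j
- 1, -j)`, whence the extra `-1`. -/
lemma mem_defectSet_refl (hS : shift '' S = S) {j : ℤ} :
    j ∈ defectSet (reflSet S) (refl a) ↔ -j - 1 ∈ defectSet S a := by
  simp only [defectSet, Set.mem_ofPred_eq, adm2_reflSet_iff hS, refl_apply, sub_add_cancel, neg_add,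
    ← sub_eq_add_neg]

lemma HasDefect.refl_bounds (hS : shift '' S = S) (h : HasDefect S L R W a) :
    defectLeft (reflSet S) (refl a) = -defectRight S a - 1 ∧
      defectRight (reflSet S) (refl a) = -defectLeft S a - 1 := by
  obtain ⟨hl, hr⟩ := h.isLeast_isGreatest
  have h1 : IsLeast (defectSet (reflSet S) (refl a)) (-defectRight S a - 1) := by
    refine ⟨(mem_defectSet_refl hS).2 ?_, fun j hj => ?_⟩
    · rw [show -(-defectRight S a - 1) - 1 = defectRight S a by ring]; exact hr.1
    · have := hr.2 ((mem_defectSet_refl hS).1 hj); omega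
  have h2 : IsGreatest (defectSet (reflSet S) (refl a)) (-defectLeft S a - 1) := by
    refine ⟨(mem_defectSet_refl hS).2 ?_, fun j hj => ?_⟩
    · rw [show -(-defectLeft S a - 1) - 1 = defectLeft S a by ring]; exact hl.1
    · have := hl.2 ((mem_defectSet_refl hS).1 hj); omega
  exact ⟨h1.csInf_eq, h2.csSup_eq⟩

lemma HasDefect.isLocalized_refl (hS : shift '' S = S) (hL : shift '' L = L)
    (hR : ∀ r ∈ R, shift^[q] r = r) (h : HasDefect S L R W a) :
    IsLocalized (reflSet S) (reflSet L) q (2 * W + 3) (defectLeft (reflSet S) (refl a))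
      (refl a) := by
  rw [(h.refl_bounds hS).1]
  obtain ⟨hl, hr⟩ := h.isLeast_isGreatest
  obtain ⟨-, -, -, hw, ⟨l, hlL, hla⟩, ⟨r, hrR, hra⟩⟩ := h
  have hlr := hl.2 hr.1
  have hpos : defectPos S a = defectLeft S a + (defectWidth S a + 1) / 2 := rfl
  have hwd : defectWidth S a = defectRight S a - defectLeft S a := rfl
  have hlo : winLo W = 1 - ((W : ℤ) + 1) / 2 := rfl
  have hhi : winHi W = (W : ℤ) / 2 := rfl
  refine ⟨⟨?_, fun j hj => ?_⟩, fun j hj => ?_, fun z hz => ?_, fun z hz => ?_⟩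
  · rw [mem_defectSet_refl hS, show -(-defectRight S a - 1) - 1 = defectRight S a by ring]
    exact hr.1
  · have := hr.2 ((mem_defectSet_refl hS).1 hj); omega
  · have := hl.2 ((mem_defectSet_refl hS).1 hj); omega
  · obtain ⟨n, hn⟩ := Int.eq_ofNat_of_zero_le (a := -z - (defectPos S a + winHi W)) (by omega)
    have e1 := hra n (by omega)
    have e2 := hra (n + q) (by omega)
    rw [show defectPos S a + winHi W + n = -z by omega] at e1
    rw [show defectPos S a + winHi W + (n + q : ℕ) = -(z - q) by push_cast; omega] at e2
    rw [refl_apply, refl_apply, e1, e2, ← eq_add_of_shift_iterate (hR r hrR) n]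
    congr 1
  · obtain ⟨n, hn⟩ := Int.eq_ofNat_of_zero_le (a := defectPos S a + winLo W + z) (by omega)
    have e1 := hla n (by omega)
    have e2 := hla (n + 1) (by omega)
    rw [show defectPos S a + winLo W - n = -z by omega] at e1
    rw [show defectPos S a + winLo W - (n + 1 : ℕ) = -(z + 1) by push_cast; omega] at e2
    rw [refl_apply, refl_apply, e1, e2, adm2_reflSet_iff hL]
    have := adm2_of_mem hL hlL (-((n + 1 : ℕ) : ℤ))
    rwa [show -((n + 1 : ℕ) : ℤ) + 1 = -(n : ℤ) by push_cast; ring] at this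

/-- With first and last defects `i` and `k`, the reflected leftmost defect is `-k - 1`. Since `w =
⌊w / 2⌋ + ⌈w / 2⌉`, adding `1 + ⌊w / 2⌋` gives `-(i + ⌈w / 2⌉)`. The change of rounding is why the
offset `κ` is left general in `offsetPos`. -/
lemma HasDefect.offsetPos_refl (hS : shift '' S = S) (h : HasDefect S L R W a) :
    offsetPos (reflSet S) (fun w => 1 + w / 2) (refl a) = -defectPos S a := by
  obtain ⟨h1, h2⟩ := h.refl_bounds hS
  have hpos : defectPos S a = defectLeft S a + (defectWidth S a + 1) / 2 := rfl
  have hwd : defectWidth S a = defectRight S a - defectLeft S a := rfl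
  rw [offsetPos, defectWidth, h1, h2, hpos, hwd]
  omega

lemma HasDefect.abs_le (h : HasDefect S L R W a) (h0 : defectPos S a = 0) :
    |defectLeft S a| ≤ 2 * W + 3 ∧ |-defectRight S a - 1| ≤ 2 * W + 3 := by
  obtain ⟨hl, hr⟩ := h.isLeast_isGreatest
  have hw := h.2.2.2.1
  have hlr := hl.2 hr.1
  have hpos : defectPos S a = defectLeft S a + (defectWidth S a + 1) / 2 := rfl
  have hwd : defectWidth S a = defectRight S a - defectLeft S a := rfl
  constructor <;> rw [_root_.abs_le] <;> omega

end Particle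

/-! ### Sign reversal of random walks, and the theorem. -/

lemma IsRandomWalk.neg {ω : Measure (ℕ → ℤ)} (h : IsRandomWalk ω) :
    IsRandomWalk (ω.map fun v n => -v n) := by
  obtain ⟨ν, ⟨N, m, ψ, hm, rfl⟩, rfl⟩ := h
  have m1 : Measurable fun (x : ℕ → Fin N) n => ψ (x n) := measurable_pi_lambda _ fun n =>
    Measurable.of_discrete.comp (measurable_pi_apply n)
  have m2 : Measurable fun (x : ℕ → Fin N) n => -ψ (x n) := measurable_pi_lambda _ fun n =>
    (Measurable.of_discrete (f := fun i => -ψ i)).comp (measurable_pi_apply n)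
  have m3 : Measurable partialSums := measurable_pi_lambda _ fun n =>
    Finset.measurable_fun_sum _ fun i _ => measurable_pi_apply i
  have m4 : Measurable fun (v : ℕ → ℤ) n => -v n := measurable_pi_lambda _ fun n =>
    (measurable_pi_apply n).neg
  refine ⟨_, ⟨N, m, fun i => -ψ i, hm, rfl⟩, ?_⟩
  rw [Measure.map_map m3 m1, Measure.map_map m4 (m3.comp m1), Measure.map_map m3 m2]
  congr 1
  funext x n
  simp [partialSums]

lemma regular_degree_ne_zero {R : Set (ℤ → A)} [Finite A] {F : ℕ} (hne : R.Nonempty)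
    (hF : ∀ b, Adm1 R b → (follSet R b).ncard = F) : F ≠ 0 := by
  obtain ⟨r, hr⟩ := hne
  have h1 := hF (r 0) ⟨r, hr, rfl⟩
  rw [← h1]
  exact Set.ncard_ne_zero_of_mem (a := r 1) ⟨r, hr, rfl, rfl⟩

end DefectWalk

end

theorem corollary3p2 {A : Type*} [Fintype A] [TopologicalSpace A] [DiscreteTopology A]
    [MeasurableSpace A] [MeasurableSingletonClass A]
    (φ : A → A → A → A) (p q : ℕ) (hp : 0 < p) (hq : 0 < q)
    (S L R : Set (ℤ → A))
    (hS : DefectWalk.IsMarkovSubshift S) (hSinv : Set.MapsTo (DefectWalk.caMap φ) S S)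
    (hLS : L ⊆ S) (hRS : R ⊆ S)
    (lam rho : Measure (ℤ → A)) [IsProbabilityMeasure lam] [IsProbabilityMeasure rho]
    (hlam : ∀ᵐ a ∂lam, a ∈ L) (hrho : ∀ᵐ a ∂rho, a ∈ R)
    (hcase :
      (DefectWalk.IsSubshift L ∧ L ⊆ DefectWalk.fixSet φ p q ∧
        DefectWalk.IsMarkovSubshift R ∧ DefectWalk.IsRightRegular R ∧
        DefectWalk.IsRightResolving φ R ∧ DefectWalk.IsParryMeasure R rho) ∨
      (DefectWalk.IsMarkovSubshift L ∧ DefectWalk.IsLeftRegular L ∧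
        DefectWalk.IsLeftResolving φ L ∧ DefectWalk.IsParryMeasure L lam ∧
        DefectWalk.IsSubshift R ∧ R ⊆ DefectWalk.fixSet φ p q))
    (W : ℕ) (δ : Measure (Fin W → A)) [IsProbabilityMeasure δ]
    (hμ : ∀ᵐ a ∂(DefectWalk.productMeasure W lam δ rho),
      a ∈ DefectWalk.particleSetZero φ S L R W) :
    DefectWalk.IsRandomWalk
      ((DefectWalk.productMeasure W lam δ rho).map
        (DefectWalk.sampledTrajectory φ S p)) := by
  open DefectWalk in
  set μ := productMeasure W lam δ rho with hμdef
  have hμp : IsProbabilityMeasure μ :=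
    Measure.isProbabilityMeasure_map (measurable_glue W).aemeasurable
  rcases hcase with ⟨-, hLfix, hRM, ⟨F, hF⟩, hres, hparry⟩ | ⟨hLM, ⟨F, hF⟩, hres, hparry, -, hRfix⟩
  · have hF0 : F ≠ 0 := regular_degree_ne_zero (hrho.exists.imp fun _ h => h) hF
    have hU : UnifFrom R F _ μ := unifFrom_productMeasure fun f => hparry.unifFrom hRM hF hF0 f
    -- With the offset `⌈w / 2⌉`, `offsetPos` unfolds to `defectPos`.
    refine (isRandomWalk_of_unifFrom (q := q) (K := 2 * W + 3) hS hSinv hRM hres hF hF0 hq p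
      (fun w => (w + 1) / 2) hU ?_ ?_).2
    · filter_upwards [hμ] with a ha t
      exact ⟨_, (ha.1 t).isLocalized hRM.1.2 fun l hl => (hLfix hl).2⟩
    · filter_upwards [hμ] with a ha
      exact ⟨((ha.1 0).abs_le ha.2).1, ha.2⟩
  · have hF' : ∀ b, Adm1 (reflSet L) b → (follSet (reflSet L) b).ncard = F := fun b hb => by
      rw [follSet_reflSet hLM.1.2]
      exact hF b (adm1_of_adm1_reflSet hb)
    have hF0 : F ≠ 0 := by
      obtain ⟨l, hl⟩ := hlam.exists
      exact regular_degree_ne_zero ⟨refl l, by simpa [mem_reflSet] using hl⟩ hF'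
    have hU : UnifFrom (reflSet L) F _ (μ.map refl) := unifFrom_productMeasure_refl fun f =>
      (hparry.map_refl hLM).unifFrom hLM.reflSet hF' hF0 f
    have hprob : IsProbabilityMeasure (μ.map refl) :=
      Measure.isProbabilityMeasure_map measurable_refl.aemeasurable
    -- Reflection is a measurable equivalence, so almost-sure statements transfer without
    -- measurability of `P`.
    have hae : ∀ P : (ℤ → A) → Prop, (∀ᵐ a ∂μ, P (refl a)) → ∀ᵐ a ∂μ.map refl, P a := fun P h =>
      (reflEquiv (A := A)).measurableEmbedding.ae_map_iff.2 h
    have hpart : ∀ᵐ a ∂μ.map refl,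
        IsParticle (reflRule φ) (reflSet S) (reflSet L) q (2 * W + 3) a := by
      refine hae _ ?_
      filter_upwards [hμ] with a ha t
      rw [iterate_caMap_reflRule]
      exact ⟨_, (ha.1 t).isLocalized_refl hS.1.2 hLM.1.2 fun r hr => (hRfix hr).2⟩
    have hpos : ∀ᵐ a ∂μ.map refl, |defectLeft (reflSet S) a| ≤ 2 * W + 3 ∧
        offsetPos (reflSet S) (fun w => 1 + w / 2) a = 0 := by
      refine hae _ ?_
      filter_upwards [hμ] with a ha
      have h0 : HasDefect S L R W a := ha.1 0
      rw [h0.offsetPos_refl hS.1.2, (h0.refl_bounds hS.1.2).1, ha.2]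
      exact ⟨(h0.abs_le ha.2).2, neg_zero⟩
    obtain ⟨hmeas, hwalk⟩ := isRandomWalk_of_unifFrom (q := q) (K := 2 * W + 3) hS.reflSet
      (mapsTo_reflSet hSinv) hLM.reflSet (hres.reflSet hLM.1.2) hF' hF0 hq p
      (fun w => 1 + w / 2) hU hpart hpos
    have m4 : Measurable fun (v : ℕ → ℤ) n => -v n := measurable_pi_lambda _ fun n =>
      (measurable_pi_apply n).neg
    have hneg := hwalk.neg
    rw [AEMeasurable.map_map_of_aemeasurable m4.aemeasurable hmeas,
      AEMeasurable.map_map_of_aemeasurable (m4.comp_aemeasurable hmeas)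
        measurable_refl.aemeasurable] at hneg
    -- Reflection negates the position at every time, so the original trajectory is the negative of
    -- the reflected one.
    convert hneg using 1
    refine Measure.map_congr ?_
    filter_upwards [hμ] with a ha
    funext k
    simp only [Function.comp_apply, iterate_caMap_reflRule, sampledTrajectory,
      (ha.1 (p * k)).offsetPos_refl hS.1.2, neg_neg]
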